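/- **Setting.** Let $\mathcal H=(C,F,D,G)$ be a hybrid system on $\mathbb R^n$, $$x\in C,\ \dot x\in F(x);\qquad x\in D,\ x^+\in G(x),$$ satisfying the hybrid basic conditions: $C,D\subset\mathbb R^n$ are closed; $F:\mathbb R^n\rightrightarrows\mathbb R^n$ is outer semicontinuous and locally bounded relative to $C$, with $F(x)$ nonempty and convex for every $x\in C$; $G:\mathbb R^n\rightrightarrows\mathbb R^n$ is outer semicontinuous and locally bounded relative to $D$, with $G(x)$ nonempty for every $x\in D$. Solutions $\varphi$ (not necessarily maximal) are hybrid arcs: functions on a nonempty hybrid time domain $\operatorname{dom}\varphi\subset\mathbb R_{\ge0}\times\mathbb N$, locally absolutely continuous in $t$ on each $I^j=\{t:(t,j)\in\operatorname{dom}\varphi\}$, with $\varphi(0,0)\in \overline C\cup D$, $\varphi(t,j)\in C$ for all $t\in\operatorname{int} I^j$, $\dot\varphi(t,j)\in F(\varphi(t,j))$ for almost all $t\in I^j$, and $\varphi(t,j)\in D$, $\varphi(t,j+1)\in G(\varphi(t,j))$ whenever $(t,j),(t,j+1)\in\operatorname{dom}\varphi$. A solution is complete if $\operatorname{dom}\varphi$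 is unbounded. **Definitions.** Let $\mathbb B$ be the open unit ball, $|z|_X=\inf_{w\in X}|z-w|$, and let $X,Y\subset\mathbb R^n$. - $X$ is *strongly forward invariant* if all solutions starting in $X$ remain in $X$. - $X$ is *stable relative to $Y$* if for all $\epsilon,\Delta>0$ there is $\delta>0$ such that every solution with $\varphi(0,0)\in Y\cap(X+\delta\mathbb B)\cap\Delta\mathbb B$ satisfies $\varphi(t,j)\in X+\epsilon\mathbb B$ for all $(t,j)\in\operatorname{dom}\varphi$. - $X$ is *attractive relative to $Y$* if for some $\delta>0$, and *globally attractive relative to $Y$* if for all $\delta>0$, every solution with $\varphi(0,0)\in Y\cap (X+\delta\mathbb B)$ satisfies $\lim_{t+j\to+\infty}|\varphi(t,j)|_X=0$ (no requirement when $\varphi$ is not complete). - The *basin of attraction* $B_X$ is the set of all points from which all solutions converge to $X$, that is, $\lim_{t+j\to+\infty}|\varphi(t,j)|_X=0$ for every solution, where a solution that is not complete is required to be bounded (no finite escape). - A compact $X$ is *UAS relative to $Y$* if it is stable and attractive relative to $Y$ and, for each compact $K\subset B_X\cap Y$ and each $\epsilon>0$, there is $T$ such that every solution with $\varphi(0,0)\in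 K$ satisfies $|\varphi(t,j)|_X\le\epsilon$ for all $(t,j)\in\operatorname{dom}\varphi$ with $t+j\ge T$. It is *UGAS relative to $Y$* if moreover $B_X\cap Y=Y$. - Solutions are *UGB relative to $Y$* if for each compact $K\subset Y$ there is $\Delta>0$ such that $\varphi(0,0)\in K$ implies $|\varphi(t,j)|<\Delta$ for all $(t,j)\in\operatorname{dom}\varphi$. **Lemma.** Assume that the closed set $\mathcal M_e\subset\mathbb R^n$ is strongly forward invariant; that the closed set $\mathcal M_i\subset\mathcal M_e$ is stable and globally attractive relative to $\mathcal M_e$; and that the nonempty compact set $\mathcal M_\circ\subset\mathcal M_i$ is stable and globally attractive relative to $\mathcal M_i$. Then $\mathcal M_\circ$ is UAS relative to $\mathcal M_e$, and $B_{\mathcal M_\circ}\cap\mathcal M_e$ is the largest subset of $\mathcal M_e$ from which all solutions are bounded. In particular, if solutions are UGB relative to $\mathcal M_e$, then $\mathcal M_\circ$ is UGAS relative to $\mathcal M_e$. Finally, if in the assumptions global attractivity is replaced by attractivity (both for $\mathcal M_i$ relative to $\mathcal M_e$ and for $\mathcal M_\circ$ relative to $\mathcal M_i$), then $\mathcal M_\circ$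 is still UAS relative to $\mathcal M_e$. -/

import Mathlib

open Filter Topology

/-- A compact hybrid time domain: `⋃_{j < J} [t j, t (j+1)] × {j}` with
`0 = t 0 ≤ t 1 ≤ ⋯ ≤ t J` (the values of `t` beyond `J` play no role). -/
def IsCompactHybridTimeDomain (E : Set (ℝ × ℕ)) : Prop :=
  ∃ (J : ℕ) (t : ℕ → ℝ), t 0 = 0 ∧ Monotone t ∧
    E = {p | p.2 < J ∧ t p.2 ≤ p.1 ∧ p.1 ≤ t (p.2 + 1)}

/-- A hybrid time domain: a subset of `ℝ≥0 × ℕ` all of whose truncations at its own points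
are compact hybrid time domains. -/
def IsHybridTimeDomain (E : Set (ℝ × ℕ)) : Prop :=
  (∀ p ∈ E, 0 ≤ p.1) ∧
    ∀ p ∈ E, IsCompactHybridTimeDomain (E ∩ {q | 0 ≤ q.1 ∧ q.1 ≤ p.1 ∧ q.2 ≤ p.2})

/-- A hybrid arc: a function on a nonempty hybrid time domain which is, for each `j`, locally
absolutely continuous in `t`. Only the values of `toFun` on `dom` are meaningful. -/
structure HybridArc (n : ℕ) where
  dom : Set (ℝ × ℕ)
  toFun : ℝ × ℕ → EuclideanSpace ℝ (Fin n)
  dom_nonempty : dom.Nonempty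
  isHybridTimeDomain : IsHybridTimeDomain dom
  locallyAbsolutelyContinuous : ∀ (j : ℕ) (a b : ℝ), (a, j) ∈ dom → (b, j) ∈ dom →
    AbsolutelyContinuousOnInterval (fun t => toFun (t, j)) a b

namespace HybridArc

variable {n : ℕ}

/-- The initial value `φ(0,0)`. -/
def init (φ : HybridArc n) : EuclideanSpace ℝ (Fin n) := φ.toFun (0, 0)

/-- The interval `I^j = {t | (t, j) ∈ dom φ}`. -/
def interval (φ : HybridArc n) (j : ℕ) : Set ℝ := {t | (t, j) ∈ φ.dom}

/-- The arc is complete: its time domain is unbounded. -/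
def IsComplete (φ : HybridArc n) : Prop :=
  ∀ T : ℝ, ∃ p ∈ φ.dom, T ≤ p.1 + p.2

/-- The arc has bounded range. -/
def IsBounded (φ : HybridArc n) : Prop := Bornology.IsBounded (φ.toFun '' φ.dom)

/-- `|φ(t,j)|_X → 0` as `t + j → +∞` with `(t,j) ∈ dom φ`. No condition is imposed if `dom φ`
is bounded. -/
def ConvergesTo (φ : HybridArc n) (X : Set (EuclideanSpace ℝ (Fin n))) : Prop :=
  Tendsto (fun p => Metric.infDist (φ.toFun p) X)
    (comap (fun p : ℝ × ℕ => p.1 + (p.2 : ℝ)) atTop ⊓ 𝓟 φ.dom) (𝓝 0)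

end HybridArc

/-- Outer semicontinuity of a set-valued map relative to a set `S`. -/
def OuterSemicontinuousRel {n : ℕ}
    (M : EuclideanSpace ℝ (Fin n) → Set (EuclideanSpace ℝ (Fin n)))
    (S : Set (EuclideanSpace ℝ (Fin n))) : Prop :=
  ∀ x ∈ S, ∀ (u v : ℕ → EuclideanSpace ℝ (Fin n)) (y : EuclideanSpace ℝ (Fin n)),
    (∀ k, u k ∈ S) → (∀ k, v k ∈ M (u k)) →
    Tendsto u atTop (𝓝 x) → Tendsto v atTop (𝓝 y) → y ∈ M x

/-- Local boundedness of a set-valued map relative to a set `S`. -/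
def LocallyBoundedRel {n : ℕ}
    (M : EuclideanSpace ℝ (Fin n) → Set (EuclideanSpace ℝ (Fin n)))
    (S : Set (EuclideanSpace ℝ (Fin n))) : Prop :=
  ∀ x ∈ S, ∃ U ∈ 𝓝 x, Bornology.IsBounded (⋃ y ∈ U ∩ S, M y)

/-- The data `(C, F, D, G)` of a hybrid system
`x ∈ C, ẋ ∈ F(x)`; `x ∈ D, x⁺ ∈ G(x)` on `ℝⁿ`. -/
structure HybridSystem (n : ℕ) where
  C : Set (EuclideanSpace ℝ (Fin n))
  F : EuclideanSpace ℝ (Fin n) → Set (EuclideanSpace ℝ (Fin n))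
  D : Set (EuclideanSpace ℝ (Fin n))
  G : EuclideanSpace ℝ (Fin n) → Set (EuclideanSpace ℝ (Fin n))

namespace HybridSystem

variable {n : ℕ}

/-- The hybrid basic conditions. -/
structure BasicConditions (H : HybridSystem n) : Prop where
  isClosed_C : IsClosed H.C
  isClosed_D : IsClosed H.D
  osc_F : OuterSemicontinuousRel H.F H.C
  locallyBounded_F : LocallyBoundedRel H.F H.C
  nonempty_F : ∀ x ∈ H.C, (H.F x).Nonempty
  convex_F : ∀ x ∈ H.C, Convex ℝ (H.F x)
  osc_G : OuterSemicontinuousRel H.G H.D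
  locallyBounded_G : LocallyBoundedRel H.G H.D
  nonempty_G : ∀ x ∈ H.D, (H.G x).Nonempty

/-- Solutions of the hybrid system (not necessarily maximal). -/
structure IsSolution (H : HybridSystem n) (φ : HybridArc n) : Prop where
  init_mem : φ.init ∈ closure H.C ∪ H.D
  flow_mem : ∀ j, ∀ t ∈ interior (φ.interval j), φ.toFun (t, j) ∈ H.C
  flow_deriv : ∀ j, ∀ᵐ t : ℝ, t ∈ interior (φ.interval j) →
    ∃ v ∈ H.F (φ.toFun (t, j)), HasDerivAt (fun s => φ.toFun (s, j)) v t
  jump : ∀ t j, (t, j) ∈ φ.dom → (t, j + 1) ∈ φ.dom →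
    φ.toFun (t, j) ∈ H.D ∧ φ.toFun (t, j + 1) ∈ H.G (φ.toFun (t, j))

/-- All solutions starting in `X` remain in `X`. -/
def StronglyForwardInvariant (H : HybridSystem n) (X : Set (EuclideanSpace ℝ (Fin n))) : Prop :=
  ∀ φ, H.IsSolution φ → φ.init ∈ X → ∀ p ∈ φ.dom, φ.toFun p ∈ X

/-- `X` is stable relative to `Y`. Here `Metric.thickening δ X` is `X + δ𝔹`. -/
def StableRel (H : HybridSystem n) (X Y : Set (EuclideanSpace ℝ (Fin n))) : Prop :=
  ∀ ε > 0, ∀ Δ > 0, ∃ δ > 0, ∀ φ, H.IsSolution φ → φ.init ∈ Y →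
    φ.init ∈ Metric.thickening δ X ∩ Metric.ball 0 Δ →
    ∀ p ∈ φ.dom, φ.toFun p ∈ Metric.thickening ε X

/-- All solutions that start in `(X + δ𝔹) ∩ Y` converge to `X`. -/
def AttractiveFromRel (H : HybridSystem n) (δ : ℝ) (X Y : Set (EuclideanSpace ℝ (Fin n))) :
    Prop :=
  ∀ φ, H.IsSolution φ → φ.init ∈ Y → φ.init ∈ Metric.thickening δ X → φ.ConvergesTo X

/-- `X` is (locally) attractive relative to `Y`. -/
def AttractiveRel (H : HybridSystem n) (X Y : Set (EuclideanSpace ℝ (Fin n))) : Prop :=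
  ∃ δ > 0, H.AttractiveFromRel δ X Y

/-- `X` is globally attractive relative to `Y`. -/
def GloballyAttractiveRel (H : HybridSystem n) (X Y : Set (EuclideanSpace ℝ (Fin n))) : Prop :=
  ∀ δ > 0, H.AttractiveFromRel δ X Y

/-- The basin of attraction of `X`: the largest set of initial conditions from which all
solutions converge to `X`. A solution that is not complete satisfies `ConvergesTo` for lack of
large times; such a solution is admitted only if it is bounded, so that a solution with finite
escape time does not count as converging to `X`. -/
def basin (H : HybridSystem n) (X : Set (EuclideanSpace ℝ (Fin n))) :
    Set (EuclideanSpace ℝ (Fin n)) :=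
  {x | ∀ φ, H.IsSolution φ → φ.init = x →
    (¬ φ.IsComplete → φ.IsBounded) ∧ φ.ConvergesTo X}

/-- `X` is uniformly attractive from `K`. -/
def UniformlyAttractiveFrom (H : HybridSystem n) (X K : Set (EuclideanSpace ℝ (Fin n))) : Prop :=
  ∀ ε > 0, ∃ T : ℝ, ∀ φ, H.IsSolution φ → φ.init ∈ K →
    ∀ p ∈ φ.dom, T ≤ p.1 + p.2 → Metric.infDist (φ.toFun p) X ≤ ε

/-- `X` is uniformly asymptotically stable relative to `Y`: it is stable and attractive relative
to `Y`, and uniformly attractive from each compact subset of its basin of attraction in `Y`. -/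
def UASRel (H : HybridSystem n) (X Y : Set (EuclideanSpace ℝ (Fin n))) : Prop :=
  H.StableRel X Y ∧ H.AttractiveRel X Y ∧
    ∀ K, IsCompact K → K ⊆ H.basin X ∩ Y → H.UniformlyAttractiveFrom X K

/-- `X` is uniformly globally asymptotically stable relative to `Y`. -/
def UGASRel (H : HybridSystem n) (X Y : Set (EuclideanSpace ℝ (Fin n))) : Prop :=
  H.UASRel X Y ∧ H.basin X ∩ Y = Y

/-- Solutions are uniformly bounded from the (compact) set `K`. -/
def UniformlyBoundedFrom (H : HybridSystem n) (K : Set (EuclideanSpace ℝ (Fin n))) : Prop :=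
  ∃ Δ > 0, ∀ φ, H.IsSolution φ → φ.init ∈ K → ∀ p ∈ φ.dom, ‖φ.toFun p‖ < Δ

/-- Solutions are uniformly globally bounded relative to `Y`. -/
def UGBRel (H : HybridSystem n) (Y : Set (EuclideanSpace ℝ (Fin n))) : Prop :=
  ∀ K, IsCompact K → K ⊆ Y → H.UniformlyBoundedFrom K

end HybridSystem

/-! The engine is sequential compactness of solutions: under the basic conditions, solutions with
bounded initial values converge graphically, along an ultrafilter, to a solution, the limit being
taken wherever they stay bounded up to the time considered (`exists_graphical_limit`). Each claim is
then proved by contradiction: solutions violating it are cut into suitable segments, whose limit is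
a solution violating a hypothesis.

Stability of `Mo` relative to `Me` (`stableRel_of_nested`): suppose that solutions starting ever
closer to `Mo` reach distance `ε`. Each is cut from its last visit to the closed `δ`-neighbourhood
to its first time at distance `ε`. Stability of `Mi` squeezes these segments onto `Mi`, so their
limit starts in `Mi`. If the lengths stay bounded, the limit reaches distance `ε`, against stability
of `Mo` relative to `Mi`; otherwise it remains at distance at least `δ` for arbitrarily long times,
against attractivity.

Attractivity (`convergesTo_of_nested`): if a bounded solution converges to `Mi` but not to `Mo`,
stability keeps it away from `Mo` on longer and longer segments that start later and later. Their
limit starts in `Mi` and does not converge to `Mo`.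

Uniformity on compact subsets of the basin (`uniformlyAttractiveFrom_of_subset_basin`) follows in
the same way, once reachable sets over finite horizons are known to be bounded in the absence of
finite escape (`exists_bound_of_length_le`). This bound also makes every solution from the basin
bounded, while global attractivity puts in the basin every point of `Me` from which all solutions
are bounded. -/

/-! ### Absolutely continuous curves. -/

/-- A mean value property: if the derivative of an absolutely continuous curve lies almost
everywhere in a closed convex set, so does its difference quotient. -/
theorem AbsolutelyContinuousOnInterval.slope_mem {V : Type*} [NormedAddCommGroup V]
    [NormedSpace ℝ V] {f : ℝ → V} {a b : ℝ} (hab : a < b)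
    (hf : AbsolutelyContinuousOnInterval f a b) {S : Set V} (hSc : Convex ℝ S)
    (hS : IsClosed S)
    (hd : ∀ᵐ t : ℝ, t ∈ Set.Ioo a b → ∃ v ∈ S, HasDerivAt f v t) :
    (b - a)⁻¹ • (f b - f a) ∈ S := by
  by_contra hx
  -- A functional `l` strictly separates the difference quotient from `S`; integrating the
  -- derivative of the scalar function `l ∘ f`, almost everywhere at most `u`, contradicts the
  -- separation.
  obtain ⟨l, u, hlS, hlx⟩ := geometric_hahn_banach_closed_point hSc hS hx
  have hac : AbsolutelyContinuousOnInterval (fun t => l (f t)) a b := by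
    unfold AbsolutelyContinuousOnInterval at hf ⊢
    refine squeeze_zero (fun t => Finset.sum_nonneg fun i _ => dist_nonneg) (fun t => ?_)
      (by simpa using Tendsto.const_mul ‖l‖ hf)
    rw [Finset.mul_sum]
    exact Finset.sum_le_sum fun i _ => by
      simpa [dist_eq_norm, map_sub] using l.le_opNorm (f (t.2 i).1 - f (t.2 i).2)
  have hint := hac.integral_deriv_eq_sub
  have hle : ∫ t in a..b, deriv (fun t => l (f t)) t ≤ ∫ t in a..b, u := by
    refine intervalIntegral.integral_mono_ae_restrict hab.le hac.intervalIntegrable_deriv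
      (by simp) ?_
    have h1 : ∀ᵐ x : ℝ, x ≠ a := by simp [MeasureTheory.ae_iff]
    have h2 : ∀ᵐ x : ℝ, x ≠ b := by simp [MeasureTheory.ae_iff]
    refine (MeasureTheory.ae_restrict_iff' measurableSet_Icc).2 ?_
    filter_upwards [hd, h1, h2] with t ht ha hb hmem
    obtain ⟨v, hv, hder⟩ := ht ⟨lt_of_le_of_ne hmem.1 (Ne.symm ha), lt_of_le_of_ne hmem.2 hb⟩
    have : HasDerivAt (fun t => l (f t)) (l v) t := l.hasFDerivAt.comp_hasDerivAt t hder
    rw [this.deriv]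
    exact (hlS v hv).le
  rw [hint, intervalIntegral.integral_const, smul_eq_mul] at hle
  rw [map_smul, map_sub, smul_eq_mul] at hlx
  have hpos : 0 < b - a := sub_pos.2 hab
  rw [inv_mul_eq_div, lt_div_iff₀ hpos] at hlx
  linarith

theorem AbsolutelyContinuousOnInterval.comp_const_add {X : Type*} [PseudoMetricSpace X]
    {f : ℝ → X} {a b c : ℝ} (hf : AbsolutelyContinuousOnInterval f (c + a) (c + b)) :
    AbsolutelyContinuousOnInterval (fun t => f (c + t)) a b := by
  rw [absolutelyContinuousOnInterval_iff] at hf ⊢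
  intro ε hε
  obtain ⟨δ, hδ, h⟩ := hf ε hε
  refine ⟨δ, hδ, fun E hE hsum => ?_⟩
  refine h (E.1, fun i => (c + (E.2 i).1, c + (E.2 i).2)) ⟨fun i hi => ?_, ?_⟩ (by simpa using hsum)
  · have := hE.1 i hi
    simp only [← Set.image_const_add_uIcc]
    exact ⟨Set.mem_image_of_mem _ this.1, Set.mem_image_of_mem _ this.2⟩
  · intro i hi j hj hij
    have h2 := hE.2 hi hj hij
    simp only [Function.onFun, Set.disjoint_left, Set.uIoc, Set.mem_Ioc] at h2 ⊢
    intro x hx hx'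
    refine h2 (a := x - c) ?_ ?_
    all_goals
      simp only [min_add_add_left, max_add_add_left] at hx hx'
      constructor <;> linarith [hx'.1, hx'.2, hx.1, hx.2]

/-! ### Hybrid time domains. -/

/-- The jump times of a hybrid time domain up to one of its points. -/
theorem IsHybridTimeDomain.exists_jump_times {E : Set (ℝ × ℕ)} (hE : IsHybridTimeDomain E)
    {p : ℝ × ℕ} (hp : p ∈ E) :
    ∃ t : ℕ → ℝ, t 0 = 0 ∧ Monotone t ∧ t (p.2 + 1) = p.1 ∧
      ∀ q : ℝ × ℕ, (q ∈ E ∧ q ≤ p) ↔ (q.2 ≤ p.2 ∧ t q.2 ≤ q.1 ∧ q.1 ≤ t (q.2 + 1)) := by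
  obtain ⟨J, t, h0, hm, hEq⟩ := hE.2 p hp
  have hmem : ∀ q : ℝ × ℕ, (q ∈ E ∧ q ≤ p) ↔ (q.2 < J ∧ t q.2 ≤ q.1 ∧ q.1 ≤ t (q.2 + 1)) := by
    intro q
    have := Set.ext_iff.1 hEq q
    simp only [Set.mem_inter_iff, Set.mem_ofPred_eq] at this
    rw [← this, Prod.le_def]
    exact ⟨fun h => ⟨h.1, hE.1 q h.1, h.2⟩, fun h => ⟨h.1, h.2.2⟩⟩
  have hpJ := ((hmem p).1 ⟨hp, le_rfl⟩)
  -- A further level would contribute the point `(t (p.2 + 1), p.2 + 1)`, which is not below `p`.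
  have hJ : J = p.2 + 1 := by
    by_contra hne
    have h2 := ((hmem (t (p.2 + 1), p.2 + 1)).2 ⟨by simp; omega, le_rfl, hm (by simp)⟩).2.2
    simp at h2
  subst hJ
  refine ⟨t, h0, hm, le_antisymm ?_ hpJ.2.2, fun q => by rw [hmem, Nat.lt_succ_iff]⟩
  exact ((hmem (t (p.2 + 1), p.2)).2 ⟨by simp, hm (by simp), le_rfl⟩).2.1

namespace IsHybridTimeDomain

variable {E : Set (ℝ × ℕ)}

theorem zero_mem (hE : IsHybridTimeDomain E) {p : ℝ × ℕ} (hp : p ∈ E) : ((0 : ℝ), 0) ∈ E := by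
  obtain ⟨t, h0, hm, -, h⟩ := hE.exists_jump_times hp
  exact ((h (0, 0)).2 ⟨Nat.zero_le _, h0.le, h0 ▸ hm (Nat.zero_le _)⟩).1

theorem zero_le (hE : IsHybridTimeDomain E) {p : ℝ × ℕ} (hp : p ∈ E) : ((0 : ℝ), 0) ≤ p :=
  ⟨hE.1 p hp, Nat.zero_le _⟩

theorem mem_of_mem_Icc (hE : IsHybridTimeDomain E) {a b s : ℝ} {j : ℕ} (ha : (a, j) ∈ E)
    (hb : (b, j) ∈ E) (hs : s ∈ Set.Icc a b) : (s, j) ∈ E := by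
  obtain ⟨t, -, -, h1, h⟩ := hE.exists_jump_times hb
  have h2 := (h (a, j)).1 ⟨ha, hs.1.trans hs.2, le_rfl⟩
  exact ((h (s, j)).2 ⟨le_rfl, h2.2.1.trans hs.1, hs.2.trans h1.ge⟩).1

theorem fst_le_of_snd_lt (hE : IsHybridTimeDomain E) {p q r : ℝ × ℕ} (hp : p ∈ E)
    (hq : q ∈ E) (hr : r ∈ E) (hqp : q ≤ p) (hrp : r ≤ p) (hlt : q.2 < r.2) : q.1 ≤ r.1 := by
  obtain ⟨t, -, hm, -, h⟩ := hE.exists_jump_times hp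
  exact (((h q).1 ⟨hq, hqp⟩).2.2.trans (hm hlt)).trans ((h r).1 ⟨hr, hrp⟩).2.1

theorem le_total (hE : IsHybridTimeDomain E) {p q r : ℝ × ℕ} (hp : p ∈ E)
    (hq : q ∈ E) (hr : r ∈ E) (hqp : q ≤ p) (hrp : r ≤ p) : q ≤ r ∨ r ≤ q := by
  rcases lt_trichotomy q.2 r.2 with h | h | h
  · exact Or.inl ⟨hE.fst_le_of_snd_lt hp hq hr hqp hrp h, h.le⟩
  · exact (_root_.le_total q.1 r.1).imp (fun h' => ⟨h', h.le⟩) (fun h' => ⟨h', h.ge⟩)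
  · exact Or.inr ⟨hE.fst_le_of_snd_lt hp hr hq hrp hqp h, h.le⟩

/-- Between two levels of a hybrid time domain there is a jump. -/
theorem exists_jump (hE : IsHybridTimeDomain E) {p q : ℝ × ℕ} (hp : p ∈ E)
    (hq : q ∈ E) (hqp : q ≤ p) (hlt : q.2 < p.2) :
    ∃ s, q.1 ≤ s ∧ s ≤ p.1 ∧ (s, q.2) ∈ E ∧ (s, q.2 + 1) ∈ E := by
  obtain ⟨t, -, hm, h1, h⟩ := hE.exists_jump_times hp
  refine ⟨t (q.2 + 1), ((h q).1 ⟨hq, hqp⟩).2.2, (hm (by omega)).trans h1.le,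
    ((h (t (q.2 + 1), q.2)).2 ⟨hqp.2, hm (by simp), le_rfl⟩).1,
    ((h (t (q.2 + 1), q.2 + 1)).2 ⟨hlt, le_rfl, hm (by simp)⟩).1⟩

/-- A point of a hybrid time domain is the origin, is preceded by flow, or is preceded by a
jump. -/
theorem eq_zero_or_flow_or_jump (hE : IsHybridTimeDomain E) {p : ℝ × ℕ} (hp : p ∈ E) :
    p = (0, 0) ∨ (∃ s < p.1, (s, p.2) ∈ E) ∨ ∃ i, p.2 = i + 1 ∧ (p.1, i) ∈ E := by
  obtain ⟨t, h0, hm, h1, h⟩ := hE.exists_jump_times hp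
  rcases (h1 ▸ hm (Nat.le_succ p.2) : t p.2 ≤ p.1).lt_or_eq with hlt | heq
  · exact Or.inr (Or.inl ⟨t p.2, hlt, ((h (t p.2, p.2)).2 ⟨le_rfl, le_rfl, hm (by simp)⟩).1⟩)
  · rcases hj : p.2 with _ | i
    · exact Or.inl (Prod.ext (by rw [← heq, hj, h0]) hj)
    · refine Or.inr (Or.inr ⟨i, rfl, ((h (p.1, i)).2 ⟨by simp [hj], ?_, ?_⟩).1⟩)
      · rw [← heq]; exact hm (by omega)
      · rw [← heq, hj]

theorem isCompact_inter_Iic (hE : IsHybridTimeDomain E) {p : ℝ × ℕ} (hp : p ∈ E) :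
    IsCompact (E ∩ Set.Iic p) := by
  obtain ⟨t, h0, hm, h1, h⟩ := hE.exists_jump_times hp
  have hcl : IsClosed (E ∩ Set.Iic p) := by
    have : E ∩ Set.Iic p = {q : ℝ × ℕ | q.2 ≤ p.2 ∧ t q.2 ≤ q.1 ∧ q.1 ≤ t (q.2 + 1)} :=
      Set.ext h
    rw [this]
    have hc : ∀ g : ℕ → ℝ, Continuous fun q : ℝ × ℕ => g q.2 :=
      fun g => continuous_of_discreteTopology.comp continuous_snd
    exact (isClosed_le continuous_snd continuous_const).inter
      ((isClosed_le (hc t) continuous_fst).inter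
        (isClosed_le continuous_fst (hc fun i => t (i + 1))))
  exact (isCompact_Icc (a := ((0 : ℝ), 0)) (b := p)).of_isClosed_subset hcl
    fun q hq => ⟨hE.zero_le hq.1, hq.2⟩

/-- Up to a unit error, every length below that of `p` is attained below `p`. -/
theorem exists_length_mem_Icc (hE : IsHybridTimeDomain E) {p : ℝ × ℕ} (hp : p ∈ E) {T : ℝ}
    (hT0 : 0 ≤ T) (hT : T ≤ p.1 + p.2) :
    ∃ q ∈ E, q ≤ p ∧ T ≤ q.1 + (q.2 : ℝ) ∧ q.1 + (q.2 : ℝ) ≤ T + 1 := by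
  have hc : Continuous fun q : ℝ × ℕ => q.1 + (q.2 : ℝ) :=
    continuous_fst.add (continuous_of_discreteTopology.comp continuous_snd)
  have hK := (hE.isCompact_inter_Iic hp).inter_right (isClosed_le continuous_const hc :
    IsClosed {q : ℝ × ℕ | T ≤ q.1 + (q.2 : ℝ)})
  -- A shortest point of length at least `T` works: if it were longer than `T + 1`, going back along
  -- a flow (not below length `T`) or across one jump would give a shorter one.
  obtain ⟨q, ⟨⟨hq, hqp⟩, hTq⟩, hmin⟩ := hK.exists_isMinOn ⟨p, ⟨hp, Set.mem_Iic.2 le_rfl⟩, hT⟩ hc.continuousOn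
  refine ⟨q, hq, hqp, hTq, ?_⟩
  by_contra! hlt
  rcases hE.eq_zero_or_flow_or_jump hq with h | ⟨s, hs, hsE⟩ | ⟨i, hi, hiE⟩
  · rw [h] at hlt
    norm_num at hlt
    linarith
  · have hs' : max s (T - q.2) < q.1 := max_lt hs (by linarith)
    have h1 : (max s (T - q.2), q.2) ∈ E := hE.mem_of_mem_Icc hsE hq ⟨le_max_left _ _, hs'.le⟩
    have h2 : q.1 + (q.2 : ℝ) ≤ max s (T - q.2) + (q.2 : ℝ) := hmin ⟨⟨h1, hs'.le.trans hqp.1, hqp.2⟩,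
      (by simpa using! (sub_le_iff_le_add.1 (le_max_right s (T - q.2))) :
        T ≤ max s (T - q.2) + (q.2 : ℝ))⟩
    linarith
  · have hi' : (q.2 : ℝ) = i + 1 := by rw [hi]; push_cast; rfl
    have h2 : q.1 + (q.2 : ℝ) ≤ q.1 + (i : ℝ) := hmin ⟨⟨hiE, hqp.1, (by have := hqp.2; simp only; omega)⟩,
      (by linarith : T ≤ q.1 + (i : ℝ))⟩
    linarith

end IsHybridTimeDomain

/-! ### Hybrid arcs: hitting times, truncations and tails. -/

namespace HybridArc

variable {n : ℕ}

theorem zero_mem_dom (φ : HybridArc n) : ((0 : ℝ), 0) ∈ φ.dom :=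
  φ.isHybridTimeDomain.zero_mem φ.dom_nonempty.some_mem

theorem continuousOn_inter_Iic (φ : HybridArc n) {p : ℝ × ℕ} (hp : p ∈ φ.dom) :
    ContinuousOn φ.toFun (φ.dom ∩ Set.Iic p) := by
  rw [continuousOn_prod_of_discrete_right]
  intro j
  obtain ⟨t, h0, hm, h1, h⟩ := φ.isHybridTimeDomain.exists_jump_times hp
  by_cases hj : j ≤ p.2
  · have hac := φ.locallyAbsolutelyContinuous j (t j) (t (j + 1))
      ((h (t j, j)).2 ⟨hj, le_rfl, hm (by simp)⟩).1
      ((h (t (j + 1), j)).2 ⟨hj, hm (by simp), le_rfl⟩).1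
    refine hac.continuousOn.mono fun s hs => ?_
    rw [Set.uIcc_of_le (hm (by simp))]
    exact ((h (s, j)).1 hs).2
  · intro s hs
    exact absurd hs.2.2 hj

/-- The first time at which an arc meets a closed set. -/
theorem exists_first_mem (φ : HybridArc n) {p : ℝ × ℕ} (hp : p ∈ φ.dom)
    {A : Set (EuclideanSpace ℝ (Fin n))} (hA : IsClosed A) (hpA : φ.toFun p ∈ A) :
    ∃ q ∈ φ.dom, q ≤ p ∧ φ.toFun q ∈ A ∧
      ∀ r ∈ φ.dom, r ≤ q → r ≠ q → φ.toFun r ∉ A := by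
  have hc : Continuous fun q : ℝ × ℕ => q.1 + (q.2 : ℝ) :=
    continuous_fst.add (continuous_of_discreteTopology.comp continuous_snd)
  have hK : IsCompact ((φ.dom ∩ Set.Iic p) ∩ φ.toFun ⁻¹' A) :=
    (φ.isHybridTimeDomain.isCompact_inter_Iic hp).of_isClosed_subset
      ((φ.continuousOn_inter_Iic hp).preimage_isClosed_of_isClosed
        (φ.isHybridTimeDomain.isCompact_inter_Iic hp).isClosed hA) Set.inter_subset_left
  -- Length is strictly monotone for the product order, so a minimiser of length has no other
  -- hitting time below it.
  obtain ⟨q, ⟨⟨hq, hqp⟩, hqA⟩, hmin⟩ := hK.exists_isMinOn ⟨p, ⟨hp, Set.mem_Iic.2 le_rfl⟩, hpA⟩ hc.continuousOn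
  refine ⟨q, hq, hqp, hqA, fun r hr hrq hne hrA => hne ?_⟩
  have h1 : q.1 + (q.2 : ℝ) ≤ r.1 + r.2 := hmin ⟨⟨hr, hrq.trans hqp⟩, hrA⟩
  have h2 : r.1 ≤ q.1 := hrq.1
  have h3 : (r.2 : ℝ) ≤ q.2 := Nat.cast_le.2 hrq.2
  exact Prod.ext (by linarith) (Nat.cast_injective (R := ℝ) (by linarith))

/-- The last time before `p` at which an arc meets a closed set. -/
theorem exists_last_mem (φ : HybridArc n) {p : ℝ × ℕ} (hp : p ∈ φ.dom)
    {A : Set (EuclideanSpace ℝ (Fin n))} (hA : IsClosed A) {p₀ : ℝ × ℕ} (hp₀ : p₀ ∈ φ.dom)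
    (hp₀p : p₀ ≤ p) (hpA : φ.toFun p₀ ∈ A) :
    ∃ q ∈ φ.dom, q ≤ p ∧ φ.toFun q ∈ A ∧
      ∀ r ∈ φ.dom, r ≤ p → q ≤ r → r ≠ q → φ.toFun r ∉ A := by
  have hc : Continuous fun q : ℝ × ℕ => q.1 + (q.2 : ℝ) :=
    continuous_fst.add (continuous_of_discreteTopology.comp continuous_snd)
  have hK : IsCompact ((φ.dom ∩ Set.Iic p) ∩ φ.toFun ⁻¹' A) :=
    (φ.isHybridTimeDomain.isCompact_inter_Iic hp).of_isClosed_subset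
      ((φ.continuousOn_inter_Iic hp).preimage_isClosed_of_isClosed
        (φ.isHybridTimeDomain.isCompact_inter_Iic hp).isClosed hA) Set.inter_subset_left
  obtain ⟨q, ⟨⟨hq, hqp⟩, hqA⟩, hmax⟩ := hK.exists_isMaxOn ⟨p₀, ⟨hp₀, hp₀p⟩, hpA⟩ hc.continuousOn
  refine ⟨q, hq, hqp, hqA, fun r hr hrp hqr hne hrA => hne ?_⟩
  have h1 : r.1 + (r.2 : ℝ) ≤ q.1 + q.2 := hmax ⟨⟨hr, hrp⟩, hrA⟩
  have h2 : q.1 ≤ r.1 := hqr.1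
  have h3 : (q.2 : ℝ) ≤ r.2 := Nat.cast_le.2 hqr.2
  exact Prod.ext (by linarith) (Nat.cast_injective (R := ℝ) (by linarith))

/-- Countably many intervals with rational endpoints cover the interior, and on each of them
absolute continuity gives bounded variation, hence differentiability almost everywhere. -/
theorem ae_differentiableAt (φ : HybridArc n) (j : ℕ) :
    ∀ᵐ t : ℝ, t ∈ interior (φ.interval j) →
      DifferentiableAt ℝ (fun s => φ.toFun (s, j)) t := by
  have h : ∀ᵐ t : ℝ, ∀ a b : ℚ, (((a : ℝ), j) ∈ φ.dom ∧ ((b : ℝ), j) ∈ φ.dom) →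
      t ∈ Set.uIcc (a : ℝ) b → DifferentiableAt ℝ (fun s => φ.toFun (s, j)) t := by
    rw [MeasureTheory.ae_all_iff]; intro a
    rw [MeasureTheory.ae_all_iff]; intro b
    by_cases hab : ((a : ℝ), j) ∈ φ.dom ∧ ((b : ℝ), j) ∈ φ.dom
    · filter_upwards [(φ.locallyAbsolutelyContinuous j a b hab.1
        hab.2).boundedVariationOn.ae_differentiableAt_of_mem_uIcc] with t ht _ using ht
    · exact Filter.Eventually.of_forall fun t h => absurd h hab
  filter_upwards [h] with t ht hti
  obtain ⟨ε, hε, hball⟩ := Metric.mem_nhds_iff.1 (mem_interior_iff_mem_nhds.1 hti)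
  obtain ⟨a, ha1, ha2⟩ := exists_rat_btwn (sub_lt_self t hε)
  obtain ⟨b, hb1, hb2⟩ := exists_rat_btwn (lt_add_of_pos_right t hε)
  refine ht a b ⟨hball ?_, hball ?_⟩ ?_
  · rw [Real.ball_eq_Ioo]; constructor <;> linarith
  · rw [Real.ball_eq_Ioo]; constructor <;> linarith
  · exact Set.Icc_subset_uIcc ⟨ha2.le, hb1.le⟩

/-- The restriction of an arc to the times up to `p`. -/
def truncate (φ : HybridArc n) (p : ℝ × ℕ) (hp : p ∈ φ.dom) : HybridArc n where
  dom := φ.dom ∩ Set.Iic p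
  toFun := φ.toFun
  dom_nonempty := ⟨p, hp, Set.mem_Iic.2 le_rfl⟩
  isHybridTimeDomain := by
    refine ⟨fun q hq => φ.isHybridTimeDomain.1 q hq.1, fun q hq => ?_⟩
    convert φ.isHybridTimeDomain.2 q hq.1 using 1
    ext r
    exact ⟨fun h => ⟨h.1.1, h.2⟩, fun h => ⟨⟨h.1, le_trans (b := q) ⟨h.2.2.1, h.2.2.2⟩ hq.2⟩, h.2⟩⟩
  locallyAbsolutelyContinuous j a b ha hb := φ.locallyAbsolutelyContinuous j a b ha.1 hb.1

/-- The arc seen from time `s` on. -/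
def tail (φ : HybridArc n) (s : ℝ × ℕ) (hs : s ∈ φ.dom) : HybridArc n where
  dom := {q | 0 ≤ q.1 ∧ s + q ∈ φ.dom}
  toFun q := φ.toFun (s + q)
  dom_nonempty := ⟨0, le_rfl, by simpa using hs⟩
  isHybridTimeDomain := by
    refine ⟨fun q hq => hq.1, fun q hq => ?_⟩
    obtain ⟨t, h0, hm, h1, h⟩ := φ.isHybridTimeDomain.exists_jump_times hq.2
    have hs' := (h s).1 ⟨hs, by
      constructor
      · simpa using hq.1
      · simp⟩
    -- The jump times from level `s.2` on, shifted by `s.1`; the maximum makes the first interval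
    -- start at `s.1` rather than at the jump preceding it.
    refine ⟨q.2 + 1, fun i => max (t (s.2 + i)) s.1 - s.1, ?_, ?_, ?_⟩
    · simp [max_eq_right hs'.2.1]
    · intro i k hik
      have := hm (show s.2 + i ≤ s.2 + k by omega)
      simp only
      gcongr
    · ext r
      have hr := h (s + r)
      simp only [Prod.snd_add, Prod.fst_add, Prod.le_def, add_le_add_iff_left] at hr
      simp only [Set.mem_inter_iff, Set.mem_ofPred_eq, Nat.lt_succ_iff, sub_le_iff_le_add,
        max_le_iff, le_sub_iff_add_le, le_max_iff]
      have hr2 : s.1 ≤ t (s.2 + r.2 + 1) := hs'.2.2.trans (hm (by omega))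
      constructor
      · rintro ⟨⟨hr0, hrE⟩, -, hle⟩
        obtain ⟨h3, h4, h5⟩ := hr.1 ⟨hrE, hle⟩
        refine ⟨h3, ⟨by linarith, by linarith⟩, Or.inl ?_⟩
        rw [← add_assoc]; linarith
      · rintro ⟨h3, ⟨h4, h5⟩, h6⟩
        have h7 := hr.2 ⟨h3, by linarith, by
          rcases h6 with h6 | h6
          · rw [← add_assoc] at h6; linarith
          · linarith⟩
        exact ⟨⟨by linarith, h7.1⟩, by linarith, h7.2⟩
  locallyAbsolutelyContinuous j a b ha hb :=
    (φ.locallyAbsolutelyContinuous (s.2 + j) (s.1 + a) (s.1 + b) ha.2 hb.2).comp_const_add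

end HybridArc

/-! ### Truncations and tails of solutions. -/

namespace HybridSystem

variable {n : ℕ} {H : HybridSystem n}

theorem IsSolution.truncate {φ : HybridArc n} (hφ : H.IsSolution φ) {p : ℝ × ℕ}
    (hp : p ∈ φ.dom) : H.IsSolution (φ.truncate p hp) where
  init_mem := hφ.init_mem
  flow_mem j t ht := hφ.flow_mem j t (interior_mono (fun _ h => h.1) ht)
  flow_deriv j := by
    filter_upwards [hφ.flow_deriv j] with t h ht using h (interior_mono (fun _ h => h.1) ht)
  jump t j h h' := hφ.jump t j h.1 h'.1

/-- At a non-final time the solution either flows on, so that its value is a limit of points of `C`,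
or jumps at once from `D`. A final value reached by a jump may lie outside both sets, which is why a
tail must start strictly before some other time. -/
theorem IsSolution.mem_closure_of_lt {φ : HybridArc n} (hφ : H.IsSolution φ) {s p : ℝ × ℕ}
    (hs : s ∈ φ.dom) (hp : p ∈ φ.dom) (hsp : s ≤ p) (hne : s ≠ p) :
    φ.toFun s ∈ closure H.C ∪ H.D := by
  have hflow : ∀ r > s.1, (r, s.2) ∈ φ.dom → φ.toFun s ∈ closure H.C := by
    intro r hr hrd
    have hac := (φ.locallyAbsolutelyContinuous s.2 s.1 r hs hrd).continuousOn
    rw [Set.uIcc_of_le hr.le] at hac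
    have h1 : Tendsto (fun t => φ.toFun (t, s.2)) (𝓝[>] s.1) (𝓝 (φ.toFun s)) :=
      ((hac s.1 (Set.left_mem_Icc.2 hr.le)).mono Set.Ioc_subset_Icc_self).tendsto.mono_left
        (nhdsWithin_Ioc_eq_nhdsGT hr).ge
    refine mem_closure_of_tendsto h1 ?_
    filter_upwards [Ioo_mem_nhdsGT hr] with t ht
    refine hφ.flow_mem s.2 t ?_
    refine mem_interior.2 ⟨Set.Ioo s.1 r, fun x hx => ?_, isOpen_Ioo, ht⟩
    exact φ.isHybridTimeDomain.mem_of_mem_Icc hs hrd ⟨hx.1.le, hx.2.le⟩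
  rcases (show s.2 ≤ p.2 from hsp.2).lt_or_eq with hlt | heq
  · obtain ⟨r, hr1, -, hr3, hr4⟩ := φ.isHybridTimeDomain.exists_jump hp hs hsp hlt
    rcases hr1.lt_or_eq with hlt' | heq'
    · exact Or.inl (hflow r hlt' hr3)
    · subst heq'
      exact Or.inr (hφ.jump _ _ hr3 hr4).1
  · refine Or.inl (hflow p.1 ?_ (by rw [heq]; exact hp))
    exact lt_of_le_of_ne hsp.1 fun h => hne (Prod.ext h heq)

theorem IsSolution.tail {φ : HybridArc n} (hφ : H.IsSolution φ) {s p : ℝ × ℕ}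
    (hs : s ∈ φ.dom) (hp : p ∈ φ.dom) (hsp : s ≤ p) (hne : s ≠ p) :
    H.IsSolution (φ.tail s hs) := by
  have hint : ∀ j t, t ∈ interior ((φ.tail s hs).interval j) →
      s.1 + t ∈ interior (φ.interval (s.2 + j)) := by
    intro j t ht
    have h1 : (fun x => s.1 + x) '' interior ((φ.tail s hs).interval j) ⊆
        φ.interval (s.2 + j) := by
      rintro _ ⟨x, hx, rfl⟩
      exact (interior_subset hx : x ∈ (φ.tail s hs).interval j).2
    exact interior_maximal h1 ((isOpenMap_add_left s.1) _ isOpen_interior) ⟨t, ht, rfl⟩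
  refine ⟨?_, fun j t ht => hφ.flow_mem _ _ (hint j t ht), fun j => ?_, fun t j h h' => ?_⟩
  · have : (φ.tail s hs).init = φ.toFun s := by
      change φ.toFun (s + (0, 0)) = _
      exact congrArg φ.toFun (add_zero s)
    rw [this]
    exact hφ.mem_closure_of_lt hs hp hsp hne
  · have h1 := (MeasureTheory.measurePreserving_add_left MeasureTheory.volume
      s.1).quasiMeasurePreserving.ae (hφ.flow_deriv (s.2 + j))
    filter_upwards [h1] with t h ht
    obtain ⟨v, hv, hd⟩ := h (hint j t ht)
    exact ⟨v, hv, hd.comp_const_add s.1 t⟩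
  · exact hφ.jump (s.1 + t) (s.2 + j) h.2 h'.2

end HybridSystem

/-! ### Outer semicontinuous, locally bounded set-valued maps. -/

section SetValued

variable {n : ℕ} {M : EuclideanSpace ℝ (Fin n) → Set (EuclideanSpace ℝ (Fin n))}
  {S : Set (EuclideanSpace ℝ (Fin n))}

theorem LocallyBoundedRel.exists_bound (hM : LocallyBoundedRel M S) (hS : IsClosed S) (R : ℝ) :
    ∃ L, 0 ≤ L ∧ ∀ x ∈ S, ‖x‖ ≤ R → ∀ v ∈ M x, ‖v‖ ≤ L := by
  have hK : IsCompact (S ∩ Metric.closedBall 0 R) := (isCompact_closedBall 0 R).inter_left hS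
  have hb : Bornology.IsBounded (⋃ y ∈ (S ∩ Metric.closedBall 0 R) ∩ S, M y) := by
    refine hK.induction_on (p := fun s => Bornology.IsBounded (⋃ y ∈ s ∩ S, M y)) (by simp)
      (fun s t hst ht => ht.subset ?_) (fun s t hs ht => ?_) (fun x hx => ?_)
    · exact Set.biUnion_subset_biUnion_left (Set.inter_subset_inter_left _ hst)
    · rw [Set.union_inter_distrib_right, Set.biUnion_union]
      exact hs.union ht
    · obtain ⟨U, hU, hUb⟩ := hM x hx.1
      exact ⟨U, mem_nhdsWithin_of_mem_nhds hU, hUb⟩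
  obtain ⟨L, hL⟩ := hb.exists_norm_le
  refine ⟨max L 0, le_max_right _ _, fun x hx hxR v hv => (hL v ?_).trans (le_max_left _ _)⟩
  exact Set.mem_biUnion (⟨⟨hx, by simpa using hxR⟩, hx⟩ :
    x ∈ (S ∩ Metric.closedBall 0 R) ∩ S) hv

/-- The definition speaks of sequences; picking indices with error below `1 / (m + 1)` extends it to
limits along any nontrivial filter, in particular along ultrafilters. -/
theorem OuterSemicontinuousRel.mem_of_tendsto (hM : OuterSemicontinuousRel M S) {ι : Type*}
    {l : Filter ι} [l.NeBot] {u v : ι → EuclideanSpace ℝ (Fin n)}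
    {x y : EuclideanSpace ℝ (Fin n)} (hx : x ∈ S) (hu : ∀ᶠ k in l, u k ∈ S)
    (hv : ∀ᶠ k in l, v k ∈ M (u k)) (hux : Tendsto u l (𝓝 x)) (hvy : Tendsto v l (𝓝 y)) :
    y ∈ M x := by
  have h : ∀ m : ℕ, ∃ k, u k ∈ S ∧ v k ∈ M (u k) ∧ dist (u k) x < 1 / ((m : ℝ) + 1) ∧
      dist (v k) y < 1 / ((m : ℝ) + 1) := fun m =>
    (hu.and (hv.and ((Metric.tendsto_nhds.1 hux _ Nat.one_div_pos_of_nat).and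
      (Metric.tendsto_nhds.1 hvy _ Nat.one_div_pos_of_nat)))).exists
  choose k h1 h2 h3 h4 using h
  refine hM x hx (fun m => u (k m)) (fun m => v (k m)) y h1 h2 ?_ ?_
  · exact tendsto_iff_dist_tendsto_zero.2 (squeeze_zero (fun _ => dist_nonneg)
      (fun m => (h3 m).le) tendsto_one_div_add_atTop_nhds_zero_nat)
  · exact tendsto_iff_dist_tendsto_zero.2 (squeeze_zero (fun _ => dist_nonneg)
      (fun m => (h4 m).le) tendsto_one_div_add_atTop_nhds_zero_nat)

theorem OuterSemicontinuousRel.isClosed (hM : OuterSemicontinuousRel M S)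
    {x : EuclideanSpace ℝ (Fin n)} (hx : x ∈ S) : IsClosed (M x) :=
  IsSeqClosed.isClosed fun v y hv hy =>
    hM x hx (fun _ => x) v y (fun _ => hx) hv tendsto_const_nhds hy

/-- Outer semicontinuity and local boundedness give upper semicontinuity. -/
theorem OuterSemicontinuousRel.exists_subset_thickening (hM : OuterSemicontinuousRel M S)
    (hb : LocallyBoundedRel M S) {x : EuclideanSpace ℝ (Fin n)} (hx : x ∈ S) {ε : ℝ}
    (hε : 0 < ε) :
    ∃ ρ > 0, ∀ y ∈ S, dist y x < ρ → M y ⊆ Metric.thickening ε (M x) := by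
  by_contra! hcon
  have h : ∀ m : ℕ, ∃ y v, y ∈ S ∧ dist y x < 1 / ((m : ℝ) + 1) ∧ v ∈ M y ∧
      v ∉ Metric.thickening ε (M x) := by
    intro m
    obtain ⟨y, hy, hd, hns⟩ := hcon _ (Nat.one_div_pos_of_nat (n := m))
    obtain ⟨v, hv, hv'⟩ := Set.not_subset.1 hns
    exact ⟨y, v, hy, hd, hv, hv'⟩
  choose u v hu hd hv hnv using h
  have hux : Tendsto u atTop (𝓝 x) :=
    tendsto_iff_dist_tendsto_zero.2 (squeeze_zero (fun _ => dist_nonneg)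
      (fun m => (hd m).le) tendsto_one_div_add_atTop_nhds_zero_nat)
  obtain ⟨W, hW, hWb⟩ := hb x hx
  have hev : ∀ᶠ m in atTop, v m ∈ ⋃ y ∈ W ∩ S, M y := by
    filter_upwards [hux hW] with m hm
    exact Set.mem_biUnion (⟨hm, hu m⟩ : u m ∈ W ∩ S) (hv m)
  obtain ⟨y, -, κ, hκ, hlim⟩ := tendsto_subseq_of_frequently_bounded hWb hev.frequently
  have hy : y ∈ M x := hM x hx (u ∘ κ) (v ∘ κ) y (fun _ => hu _) (fun _ => hv _)
    (hux.comp hκ.tendsto_atTop) hlim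
  obtain ⟨m, hm⟩ := (Metric.tendsto_nhds.1 hlim ε hε).exists
  exact hnv _ (Metric.mem_thickening_iff.2 ⟨y, hy, hm⟩)

end SetValued

/-! ### A priori bounds on solutions. -/

namespace HybridSystem

variable {n : ℕ} {H : HybridSystem n} {φ : HybridArc n}

theorem IsSolution.ae_flow (hφ : H.IsSolution φ) {a b : ℝ} {j : ℕ} (ha : (a, j) ∈ φ.dom)
    (hb : (b, j) ∈ φ.dom) : ∀ᵐ t : ℝ, t ∈ Set.Ioo a b → φ.toFun (t, j) ∈ H.C ∧
      ∃ v ∈ H.F (φ.toFun (t, j)), HasDerivAt (fun s => φ.toFun (s, j)) v t := by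
  filter_upwards [hφ.flow_deriv j] with t h ht
  have : t ∈ interior (φ.interval j) := by
    refine mem_interior.2 ⟨Set.Ioo a b, fun x hx => ?_, isOpen_Ioo, ht⟩
    exact φ.isHybridTimeDomain.mem_of_mem_Icc ha hb ⟨hx.1.le, hx.2.le⟩
  exact ⟨hφ.flow_mem j t this, h this⟩

/-- Where a solution is bounded by `R`, it is Lipschitz during flows. -/
theorem IsSolution.norm_sub_le (hφ : H.IsSolution φ) {R L : ℝ}
    (hL : ∀ x ∈ H.C, ‖x‖ ≤ R → ∀ v ∈ H.F x, ‖v‖ ≤ L) {a b : ℝ} {j : ℕ} (hab : a ≤ b)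
    (ha : (a, j) ∈ φ.dom) (hb : (b, j) ∈ φ.dom)
    (hR : ∀ r ∈ φ.dom, r ≤ (b, j) → ‖φ.toFun r‖ ≤ R) :
    ‖φ.toFun (b, j) - φ.toFun (a, j)‖ ≤ L * (b - a) := by
  rcases hab.lt_or_eq with hlt | rfl
  · have h := (φ.locallyAbsolutelyContinuous j a b ha hb).slope_mem hlt
      (convex_closedBall 0 L) Metric.isClosed_closedBall (by
        filter_upwards [hφ.ae_flow ha hb] with t h ht
        obtain ⟨hC, v, hv, hd⟩ := h ht
        refine ⟨v, ?_, hd⟩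
        simpa using hL _ hC (hR _ (φ.isHybridTimeDomain.mem_of_mem_Icc ha hb
          ⟨ht.1.le, ht.2.le⟩) ⟨ht.2.le, le_rfl⟩) v hv)
    have hpos : 0 < b - a := sub_pos.2 hlt
    rw [mem_closedBall_zero_iff, norm_smul, norm_inv, Real.norm_of_nonneg hpos.le,
      inv_mul_le_iff₀ hpos] at h
    linarith
  · simp

/-- A bound before `p` gives a bound at `p`. -/
theorem IsSolution.norm_le_of_before (hφ : H.IsSolution φ) {R L : ℝ}
    (hL : ∀ x ∈ H.D, ‖x‖ ≤ R → ∀ v ∈ H.G x, ‖v‖ ≤ L) {p : ℝ × ℕ} (hp : p ∈ φ.dom)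
    (h0 : ‖φ.init‖ ≤ R) (hR : ∀ r ∈ φ.dom, r ≤ p → r ≠ p → ‖φ.toFun r‖ ≤ R) :
    ‖φ.toFun p‖ ≤ max R L := by
  -- At the end of a flow the bound `R` survives by continuity; only a jump can exceed it, and then
  -- its value is bounded by `L`.
  rcases φ.isHybridTimeDomain.eq_zero_or_flow_or_jump hp with rfl | ⟨s, hs, hsd⟩ | ⟨i, hi, hid⟩
  · exact h0.trans (le_max_left _ _)
  · have hac := (φ.locallyAbsolutelyContinuous p.2 s p.1 hsd hp).continuousOn
    rw [Set.uIcc_of_le hs.le] at hac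
    have h1 : Tendsto (fun t => φ.toFun (t, p.2)) (𝓝[<] p.1) (𝓝 (φ.toFun p)) :=
      ((hac p.1 (Set.right_mem_Icc.2 hs.le)).mono Set.Ico_subset_Icc_self).tendsto.mono_left
        (nhdsWithin_Ico_eq_nhdsLT hs).ge
    refine le_trans (le_of_tendsto h1.norm ?_) (le_max_left _ _)
    filter_upwards [Ioo_mem_nhdsLT hs] with t ht
    refine hR _ (φ.isHybridTimeDomain.mem_of_mem_Icc hsd hp ⟨ht.1.le, ht.2.le⟩)
      ⟨ht.2.le, le_rfl⟩ fun h => ht.2.ne (congrArg Prod.fst h)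
  · have hpe : p = (p.1, i + 1) := Prod.ext rfl hi
    rw [hpe] at hp
    obtain ⟨hD, hG⟩ := hφ.jump p.1 i hid hp
    rw [hpe]
    refine (hL _ hD (hR _ hid ⟨le_rfl, by simp [hi]⟩ fun h => ?_) _ hG).trans (le_max_right _ _)
    have := congrArg Prod.snd h
    simp only at this
    omega

end HybridSystem

/-! ### Graphical limits along an ultrafilter. -/

namespace HybridArc

variable {n : ℕ} {ι : Type*}

/-- Eventually along `U`, the times `q k` lie in the domains of the arcs `φ k`, which are bounded
by `R` up to `q k`, and `q k` tends to `p`. -/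
structure ApproxTime (U : Ultrafilter ι) (φ : ι → HybridArc n) (R : ℝ) (q : ι → ℝ × ℕ)
    (p : ℝ × ℕ) : Prop where
  mem_dom : ∀ᶠ k in (U : Filter ι), q k ∈ (φ k).dom
  norm_le : ∀ᶠ k in (U : Filter ι), ∀ r ∈ (φ k).dom, r ≤ q k → ‖(φ k).toFun r‖ ≤ R
  tendsto : Tendsto q U (𝓝 p)

/-- `(p, x)` belongs to the graphical limit of the arcs `φ k` along `U`. -/
def IsLimitPoint (U : Ultrafilter ι) (φ : ι → HybridArc n) (p : ℝ × ℕ)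
    (x : EuclideanSpace ℝ (Fin n)) : Prop :=
  ∃ q R, ApproxTime U φ R q p ∧ Tendsto (fun k => (φ k).toFun (q k)) U (𝓝 x)

variable {U : Ultrafilter ι} {φ : ι → HybridArc n}

/-- This replaces the extraction of subsequences: all limits are taken along the same ultrafilter,
so no diagonal argument is needed. -/
theorem exists_tendsto_of_eventually_mem {X : Type*} [TopologicalSpace X] {K : Set X}
    (hK : IsCompact K) {f : ι → X} (hf : ∀ᶠ k in (U : Filter ι), f k ∈ K) :
    ∃ x ∈ K, Tendsto f U (𝓝 x) := by
  obtain ⟨x, hx, hle⟩ := isCompact_iff_ultrafilter_le_nhds.1 hK (U.map f) (le_principal_iff.2 hf)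
  exact ⟨x, hx, hle⟩

theorem eventually_snd_eq {q : ι → ℝ × ℕ} {p : ℝ × ℕ} (h : Tendsto q U (𝓝 p)) :
    ∀ᶠ k in (U : Filter ι), (q k).2 = p.2 := by
  have := (continuous_snd.tendsto p).comp h
  rw [nhds_discrete] at this
  exact tendsto_pure.1 this

theorem ApproxTime.snd_eq {R : ℝ} {q : ι → ℝ × ℕ} {p : ℝ × ℕ} (h : ApproxTime U φ R q p) :
    ∀ᶠ k in (U : Filter ι), (q k).2 = p.2 :=
  eventually_snd_eq h.tendsto

theorem ApproxTime.fst_tendsto {R : ℝ} {q : ι → ℝ × ℕ} {p : ℝ × ℕ}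
    (h : ApproxTime U φ R q p) : Tendsto (fun k => (q k).1) U (𝓝 p.1) :=
  (continuous_fst.tendsto p).comp h.tendsto

theorem ApproxTime.exists_isLimitPoint {R : ℝ} {q : ι → ℝ × ℕ} {p : ℝ × ℕ}
    (h : ApproxTime U φ R q p) : ∃ x, IsLimitPoint U φ p x := by
  have hev : ∀ᶠ k in (U : Filter ι), (φ k).toFun (q k) ∈ Metric.closedBall 0 R := by
    filter_upwards [h.mem_dom, h.norm_le] with k h1 h2
    simpa using h2 _ h1 le_rfl
  obtain ⟨x, -, hx⟩ := exists_tendsto_of_eventually_mem (isCompact_closedBall _ _) hev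
  exact ⟨x, q, R, h, hx⟩

theorem exists_tendsto_of_length_le {q : ι → ℝ × ℕ} {T : ℝ}
    (hq : ∀ᶠ k in (U : Filter ι), q k ∈ (φ k).dom)
    (hT : ∀ᶠ k in (U : Filter ι), (q k).1 + ((q k).2 : ℝ) ≤ T) :
    ∃ p, Tendsto q U (𝓝 p) := by
  have hev : ∀ᶠ k in (U : Filter ι), q k ∈ Set.Icc ((0 : ℝ), 0) (T, ⌈T⌉₊) := by
    filter_upwards [hq, hT] with k h1 h2
    have h3 := (φ k).isHybridTimeDomain.1 _ h1
    have h4 : (0 : ℝ) ≤ (q k).2 := Nat.cast_nonneg _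
    refine ⟨⟨h3, Nat.zero_le _⟩, (by linarith : (q k).1 ≤ T), ?_⟩
    exact Nat.cast_le.1 ((by linarith : ((q k).2 : ℝ) ≤ T).trans (Nat.le_ceil T))
  obtain ⟨p, -, hp⟩ := exists_tendsto_of_eventually_mem isCompact_Icc hev
  exact ⟨p, hp⟩

theorem ApproxTime.mono {R : ℝ} {q q' : ι → ℝ × ℕ} {p p' : ℝ × ℕ}
    (h : ApproxTime U φ R q p) (hle : ∀ᶠ k in (U : Filter ι), q' k ≤ q k)
    (hmem : ∀ᶠ k in (U : Filter ι), q' k ∈ (φ k).dom) (hq' : Tendsto q' U (𝓝 p')) :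
    ApproxTime U φ R q' p' where
  mem_dom := hmem
  norm_le := by
    filter_upwards [h.norm_le, hle] with k h1 h2 r hr hrq using h1 r hr (hrq.trans h2)
  tendsto := hq'

theorem tendsto_level {f : ι → ℝ} {s : ℝ} (hf : Tendsto f U (𝓝 s)) (j : ℕ) :
    Tendsto (fun k => (f k, j)) U (𝓝 (s, j)) :=
  hf.prodMk_nhds tendsto_const_nhds

/-- Times between two approximable times of the same level are approximable. -/
theorem ApproxTime.segment {R Ra a b s : ℝ} {j : ℕ} {qa qb : ι → ℝ × ℕ}
    (ha : ApproxTime U φ Ra qa (a, j)) (hb : ApproxTime U φ R qb (b, j))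
    (hs : s ∈ Set.Icc a b) :
    ApproxTime U φ R (fun k => (min (qb k).1 (max (qa k).1 s), j)) (s, j) := by
  -- The time `s` is clamped between those of `qa k` and `qb k`. The bound comes from `qb` alone,
  -- because the clamped time is below it.
  refine hb.mono ?_ ?_ (tendsto_level ?_ j)
  · filter_upwards [hb.snd_eq] with k h
    exact ⟨min_le_left _ _, h.ge⟩
  · filter_upwards [ha.snd_eq, hb.snd_eq, ha.mem_dom, hb.mem_dom] with k h1 h2 h3 h4
    have h3' : ((qa k).1, j) ∈ (φ k).dom := by
      rwa [show ((qa k).1, j) = qa k from Prod.ext rfl h1.symm]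
    have h4' : ((qb k).1, j) ∈ (φ k).dom := by
      rwa [show ((qb k).1, j) = qb k from Prod.ext rfl h2.symm]
    rcases le_total (qa k).1 (qb k).1 with h | h
    · exact (φ k).isHybridTimeDomain.mem_of_mem_Icc h3' h4'
        ⟨le_min h (le_max_left _ _), min_le_left _ _⟩
    · rwa [min_eq_left (h.trans (le_max_left _ _))]
  · have := hb.fst_tendsto.min (ha.fst_tendsto.max (tendsto_const_nhds (x := s)))
    simpa [hs.1, hs.2] using this

end HybridArc

namespace HybridSystem

open HybridArc

variable {n : ℕ} {ι : Type*} {U : Ultrafilter ι} {φ : ι → HybridArc n} {H : HybridSystem n}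

theorem norm_sub_le_of_approxTime (hsol : ∀ k, H.IsSolution (φ k)) {R L : ℝ} {j : ℕ}
    (hL : ∀ x ∈ H.C, ‖x‖ ≤ R → ∀ v ∈ H.F x, ‖v‖ ≤ L)
    {q q' : ι → ℝ × ℕ} {s s' : ℝ} (h : ApproxTime U φ R q (s, j))
    (h' : ApproxTime U φ R q' (s', j)) :
    ∀ᶠ k in (U : Filter ι), ‖(φ k).toFun (q' k) - (φ k).toFun (q k)‖ ≤
      L * |(q' k).1 - (q k).1| := by
  filter_upwards [h.snd_eq, h'.snd_eq, h.mem_dom, h'.mem_dom, h.norm_le, h'.norm_le]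
    with k h1 h2 h3 h4 h5 h6
  have e1 : q k = ((q k).1, j) := Prod.ext rfl h1
  have e2 : q' k = ((q' k).1, j) := Prod.ext rfl h2
  rw [e1] at h3 h5
  rw [e2] at h4 h6
  rw [e1, e2]
  rcases le_total (q k).1 (q' k).1 with hle | hle
  · rw [abs_of_nonneg (sub_nonneg.2 hle)]
    exact (hsol k).norm_sub_le hL hle h3 h4 h6
  · rw [abs_sub_comm, abs_of_nonneg (sub_nonneg.2 hle), norm_sub_rev]
    exact (hsol k).norm_sub_le hL hle h4 h3 h5

/-- The value of the graphical limit does not depend on the approximating times. -/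
theorem tendsto_of_isLimitPoint (hH : H.BasicConditions) (hsol : ∀ k, H.IsSolution (φ k))
    {p : ℝ × ℕ} {x : EuclideanSpace ℝ (Fin n)} (hx : IsLimitPoint U φ p x) {R : ℝ}
    {q : ι → ℝ × ℕ} (hq : ApproxTime U φ R q p) :
    Tendsto (fun k => (φ k).toFun (q k)) U (𝓝 x) := by
  obtain ⟨q', R', hq', hx⟩ := hx
  obtain ⟨L, -, hL⟩ := hH.locallyBounded_F.exists_bound hH.isClosed_C (max R' R)
  have h1 : ApproxTime U φ (max R' R) q (p.1, p.2) :=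
    ⟨hq.1, hq.2.mono fun k h r hr hle => (h r hr hle).trans (le_max_right _ _), hq.3⟩
  have h2 : ApproxTime U φ (max R' R) q' (p.1, p.2) :=
    ⟨hq'.1, hq'.2.mono fun k h r hr hle => (h r hr hle).trans (le_max_left _ _), hq'.3⟩
  -- Both families of times are eventually on the same level and have the same limit, so the common
  -- Lipschitz bound along flows makes the values merge.
  have h3 := norm_sub_le_of_approxTime hsol hL h2 h1
  have h4 : Tendsto (fun k => L * |(q k).1 - (q' k).1|) U (𝓝 0) := by
    simpa using ((h1.fst_tendsto.sub h2.fst_tendsto).abs.const_mul L)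
  have h5 := squeeze_zero_norm' h3 h4
  simpa using h5.add hx

/-- The jump times of the arcs up to `q k` converge along the ultrafilter, and their limits `τ` are
the jump times of the limit domain truncated at `p`. The greatest time in each domain serves to
compare any two of its times. -/
theorem isHybridTimeDomain_limit (htop : ∀ k, ∃ p ∈ (φ k).dom, (φ k).dom ⊆ Set.Iic p) :
    IsHybridTimeDomain {p | ∃ x, IsLimitPoint U φ p x} := by
  have hnonneg : ∀ p ∈ {p | ∃ x, IsLimitPoint U φ p x}, 0 ≤ p.1 := by
    rintro p ⟨x, q, R, hq, -⟩
    exact ge_of_tendsto hq.fst_tendsto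
      (hq.mem_dom.mono fun k hk => (φ k).isHybridTimeDomain.1 _ hk)
  refine ⟨hnonneg, ?_⟩
  rintro p ⟨x, q, R, hq, -⟩
  have hex : ∀ k, ∃ t : ℕ → ℝ, q k ∈ (φ k).dom → t 0 = 0 ∧ Monotone t ∧
      t ((q k).2 + 1) = (q k).1 ∧ ∀ r : ℝ × ℕ, (r ∈ (φ k).dom ∧ r ≤ q k) ↔
        (r.2 ≤ (q k).2 ∧ t r.2 ≤ r.1 ∧ r.1 ≤ t (r.2 + 1)) := by
    intro k
    by_cases hk : q k ∈ (φ k).dom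
    · obtain ⟨t, ht⟩ := (φ k).isHybridTimeDomain.exists_jump_times hk
      exact ⟨t, fun _ => ht⟩
    · exact ⟨0, fun h => absurd h hk⟩
  choose t ht using hex
  -- Jump times with index beyond `p.2 + 1` are not controlled, hence the cap on the index.
  have hlim : ∀ i, ∃ τ, Tendsto (fun k => t k (min i (p.2 + 1))) U (𝓝 τ) := by
    intro i
    have hev : ∀ᶠ k in (U : Filter ι), t k (min i (p.2 + 1)) ∈ Set.Icc 0 (p.1 + 1) := by
      filter_upwards [hq.mem_dom, hq.snd_eq, hq.fst_tendsto.eventually_le_const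
        (lt_add_one p.1)] with k h1 h2 h3
      obtain ⟨h0, hm, htop, -⟩ := ht k h1
      refine ⟨h0 ▸ hm (Nat.zero_le _), (hm (min_le_right _ _)).trans ?_⟩
      rw [← h2, htop]
      exact h3
    obtain ⟨τ, -, hτ⟩ := exists_tendsto_of_eventually_mem isCompact_Icc hev
    exact ⟨τ, hτ⟩
  choose τ hτ using hlim
  have hτ' : ∀ i ≤ p.2 + 1, Tendsto (fun k => t k i) U (𝓝 (τ i)) := by
    intro i hi
    simpa [min_eq_left hi] using hτ i
  have hτ0 : τ 0 = 0 := by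
    refine tendsto_nhds_unique (hτ' 0 (Nat.zero_le _)) (tendsto_const_nhds.congr' ?_)
    filter_upwards [hq.mem_dom] with k hk using (ht k hk).1.symm
  have hτm : Monotone τ := by
    intro i i' hii
    refine le_of_tendsto_of_tendsto (hτ i) (hτ i') ?_
    filter_upwards [hq.mem_dom] with k hk using (ht k hk).2.1 (min_le_min_right _ hii)
  have hτtop : τ (p.2 + 1) = p.1 := by
    refine tendsto_nhds_unique (hτ' _ le_rfl) (hq.fst_tendsto.congr' ?_)
    filter_upwards [hq.mem_dom, hq.snd_eq] with k hk h2
    rw [← (ht k hk).2.2.1, h2]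
  refine ⟨p.2 + 1, τ, hτ0, hτm, Set.ext fun r => ⟨?_, ?_⟩⟩
  · rintro ⟨⟨y, q', R', hq', -⟩, -, hr1, hr2⟩
    have hchain : ∀ᶠ k in (U : Filter ι), q' k ≤ q k ∨ q k ≤ q' k := by
      filter_upwards [hq.mem_dom, hq'.mem_dom] with k h1 h2
      obtain ⟨P, hP, hPtop⟩ := htop k
      exact (φ k).isHybridTimeDomain.le_total hP h2 h1 (hPtop h2) (hPtop h1)
    refine ⟨Nat.lt_succ_of_le hr2, ?_, ?_⟩
    · refine le_of_tendsto_of_tendsto (hτ' r.2 (by omega)) hq'.fst_tendsto ?_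
      filter_upwards [hchain, hq.mem_dom, hq'.mem_dom, hq.snd_eq, hq'.snd_eq]
        with k h1 h2 h3 h4 h5
      rcases h1 with h1 | h1
      · have := (((ht k h2).2.2.2 _).1 ⟨h3, h1⟩).2.1
        rwa [h5] at this
      · have := (((ht k h2).2.2.2 _).1 ⟨h2, le_rfl⟩).2.1
        exact ((ht k h2).2.1 (by omega)).trans (this.trans h1.1)
    · rcases hr2.lt_or_eq with hlt | heq
      · refine le_of_tendsto_of_tendsto hq'.fst_tendsto (hτ' (r.2 + 1) (by omega)) ?_
        filter_upwards [hchain, hq.mem_dom, hq'.mem_dom, hq.snd_eq, hq'.snd_eq]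
          with k h1 h2 h3 h4 h5
        rcases h1 with h1 | h1
        · have := (((ht k h2).2.2.2 _).1 ⟨h3, h1⟩).2.2
          rwa [h5] at this
        · have := h1.2
          omega
      · rw [heq, hτtop]
        exact hr1
  · rintro ⟨h1, h2, h3⟩
    have hr0 : 0 ≤ r.1 := (hτ0 ▸ hτm (Nat.zero_le _) : 0 ≤ τ r.2).trans h2
    have hr1 : r.1 ≤ p.1 := h3.trans (hτtop ▸ hτm h1)
    refine ⟨?_, hr0, hr1, Nat.lt_succ_iff.1 h1⟩
    -- Clamping `r.1` between consecutive jump times of the arc gives approximating times for `r`.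
    have hdom : ∀ᶠ k in (U : Filter ι),
        (max (t k r.2) (min r.1 (t k (r.2 + 1))), r.2) ∈ (φ k).dom ∧
        (max (t k r.2) (min r.1 (t k (r.2 + 1))), r.2) ≤ q k := by
      filter_upwards [hq.mem_dom, hq.snd_eq] with k h4 h5
      refine ((ht k h4).2.2.2 _).2 ⟨?_, le_max_left _ _, ?_⟩
      · simp only; omega
      · exact max_le ((ht k h4).2.1 (Nat.le_succ _)) (min_le_right _ _)
    have htend : Tendsto (fun k => max (t k r.2) (min r.1 (t k (r.2 + 1)))) U (𝓝 r.1) := by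
      have := (hτ' r.2 (by omega)).max
        ((tendsto_const_nhds (x := r.1)).min (hτ' (r.2 + 1) (by omega)))
      simpa [h2, h3] using this
    exact (hq.mono (hdom.mono fun k h => h.2) (hdom.mono fun k h => h.1)
      (tendsto_level htend r.2)).exists_isLimitPoint

/-- Near an interior time of the graphical limit, the approximating arcs are eventually defined
and uniformly bounded. -/
theorem exists_eventually_mem_dom {t : ℝ} {j : ℕ}
    (ht : t ∈ interior {s : ℝ | ∃ x, IsLimitPoint U φ (s, j) x}) :
    ∃ η > 0, ∃ R, ∀ᶠ k in (U : Filter ι), ∀ s ∈ Set.Ioo (t - η) (t + η),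
      (s, j) ∈ (φ k).dom ∧ ∀ r ∈ (φ k).dom, r ≤ (s, j) → ‖(φ k).toFun r‖ ≤ R := by
  obtain ⟨η, hη, hball⟩ := Metric.mem_nhds_iff.1 (mem_interior_iff_mem_nhds.1 ht)
  have hmem : ∀ s, |s - t| < η → ∃ x, IsLimitPoint U φ (s, j) x := fun s hs =>
    hball (by rwa [Metric.mem_ball, Real.dist_eq])
  obtain ⟨-, qa, Ra, ha, -⟩ := hmem (t - η / 2) (by
    rw [abs_lt]; constructor <;> linarith)
  obtain ⟨-, qb, R, hb, -⟩ := hmem (t + η / 2) (by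
    rw [abs_lt]; constructor <;> linarith)
  refine ⟨η / 4, by linarith, R, ?_⟩
  filter_upwards [ha.snd_eq, hb.snd_eq, ha.mem_dom, hb.mem_dom, hb.norm_le,
    ha.fst_tendsto.eventually_le_const (show t - η / 2 < t - η / 4 by linarith),
    hb.fst_tendsto.eventually_const_le (show t + η / 4 < t + η / 2 by linarith)]
    with k h1 h2 h3 h4 h5 h6 h7 s hs
  have e1 : qa k = ((qa k).1, j) := Prod.ext rfl h1
  have e2 : qb k = ((qb k).1, j) := Prod.ext rfl h2
  rw [e1] at h3
  rw [e2] at h4 h5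
  have hsb : s ≤ (qb k).1 := hs.2.le.trans h7
  exact ⟨(φ k).isHybridTimeDomain.mem_of_mem_Icc h3 h4 ⟨h6.trans hs.1.le, hsb⟩,
    fun r hr hrs => h5 r hr (hrs.trans ⟨hsb, le_rfl⟩)⟩

/-- Sequential compactness of solutions: the graphical limit of locally bounded solutions is a
solution. -/
theorem exists_graphical_limit (hH : H.BasicConditions) (hsol : ∀ k, H.IsSolution (φ k))
    (htop : ∀ k, ∃ p ∈ (φ k).dom, (φ k).dom ⊆ Set.Iic p) {R₀ : ℝ}
    (hinit : ∀ᶠ k in (U : Filter ι), ‖(φ k).init‖ ≤ R₀) :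
    ∃ ψ : HybridArc n, H.IsSolution ψ ∧ (∀ p ∈ ψ.dom, IsLimitPoint U φ p (ψ.toFun p)) ∧
      ∀ R q p, ApproxTime U φ R q p →
        p ∈ ψ.dom ∧ Tendsto (fun k => (φ k).toFun (q k)) U (𝓝 (ψ.toFun p)) := by
  classical
  -- The value chosen on the limit domain is immaterial: by `hft`, all approximating times of a
  -- point yield it. Elsewhere it defaults to `0`.
  have hfun : ∃ f : ℝ × ℕ → EuclideanSpace ℝ (Fin n),
      ∀ p, (∃ x, IsLimitPoint U φ p x) → IsLimitPoint U φ p (f p) := by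
    refine ⟨fun p => if h : ∃ x, IsLimitPoint U φ p x then h.choose else 0, fun p h => ?_⟩
    simp only [h, dite_true]
    exact h.choose_spec
  obtain ⟨f, hf⟩ := hfun
  have hft : ∀ R q p, ApproxTime U φ R q p →
      Tendsto (fun k => (φ k).toFun (q k)) U (𝓝 (f p)) := fun R q p h =>
    tendsto_of_isLimitPoint hH hsol (hf p h.exists_isLimitPoint) h
  have h00 : ApproxTime U φ R₀ (fun _ => (0, 0)) (0, 0) := by
    refine ⟨Eventually.of_forall fun k => (φ k).zero_mem_dom, ?_, tendsto_const_nhds⟩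
    filter_upwards [hinit] with k hk r hr hle
    rwa [le_antisymm hle ((φ k).isHybridTimeDomain.zero_le hr)]
  let ψ : HybridArc n :=
    { dom := {p | ∃ x, IsLimitPoint U φ p x}
      toFun := f
      dom_nonempty := ⟨_, h00.exists_isLimitPoint⟩
      isHybridTimeDomain := isHybridTimeDomain_limit htop
      locallyAbsolutelyContinuous := by
        intro j a b ha hb
        wlog hab : a ≤ b generalizing a b
        · exact (this b a hb ha (le_of_not_ge hab)).symm
        obtain ⟨-, qa, Ra, ha, -⟩ := ha
        obtain ⟨-, qb, R, hb, -⟩ := hb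
        obtain ⟨L, hL0, hL⟩ := hH.locallyBounded_F.exists_bound hH.isClosed_C R
        refine LipschitzOnWith.absolutelyContinuousOnInterval (K := ⟨L, hL0⟩) ?_
        rw [Set.uIcc_of_le hab]
        refine LipschitzOnWith.of_dist_le_mul fun s hs s' hs' => ?_
        have h1 := ha.segment hb hs
        have h2 := ha.segment hb hs'
        rw [dist_eq_norm, Real.dist_eq]
        exact le_of_tendsto_of_tendsto ((hft _ _ _ h1).sub (hft _ _ _ h2)).norm
          ((h1.fst_tendsto.sub h2.fst_tendsto).abs.const_mul L)
          (norm_sub_le_of_approxTime hsol hL h2 h1) }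
  have hC : ∀ j, ∀ t ∈ interior (ψ.interval j), f (t, j) ∈ H.C := by
    intro j t ht
    obtain ⟨η, hη, R, hev⟩ := exists_eventually_mem_dom ht
    have htm : t ∈ Set.Ioo (t - η) (t + η) := ⟨by linarith, by linarith⟩
    have hap : ApproxTime U φ R (fun _ => (t, j)) (t, j) :=
      ⟨hev.mono fun k h => (h t htm).1, hev.mono fun k h => (h t htm).2, tendsto_const_nhds⟩
    refine hH.isClosed_C.mem_of_tendsto (hft _ _ _ hap) ?_
    filter_upwards [hev] with k hk
    exact (hsol k).flow_mem j t
      (mem_interior.2 ⟨Set.Ioo (t - η) (t + η), fun s hs => (hk s hs).1, isOpen_Ioo, htm⟩)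
  refine ⟨ψ, ⟨?_, hC, fun j => ?_, fun t j h h' => ?_⟩, fun p hp => hf p hp,
    fun R q p h => ⟨h.exists_isLimitPoint, hft R q p h⟩⟩
  · exact (isClosed_closure.union hH.isClosed_D).mem_of_tendsto (hft _ _ _ h00)
      (Eventually.of_forall fun k => (hsol k).init_mem)
  · filter_upwards [ψ.ae_differentiableAt j] with t hd ht
    have hx := hC j t ht
    refine ⟨_, ?_, (hd ht).hasDerivAt⟩
    have hder := (hd ht).hasDerivAt.tendsto_slope_zero_right
    set v := deriv (fun s => ψ.toFun (s, j)) t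
    have hclosed := hH.osc_F.isClosed hx
    change v ∈ H.F (f (t, j))
    -- `F` at the limit point is the intersection of its closed `ε`-thickenings, which are convex.
    -- By the mean value property these contain the difference quotients of `φ k` over short steps
    -- `h`; letting first `k` and then `h` go to the limit places `v` there.
    rw [← hclosed.closure_eq, Metric.closure_eq_iInter_cthickening]
    refine Set.mem_iInter₂.2 fun ε hε => ?_
    obtain ⟨ρ, hρ, hρF⟩ := hH.osc_F.exists_subset_thickening hH.locallyBounded_F hx hε
    obtain ⟨η, hη, R, hev⟩ := exists_eventually_mem_dom ht
    obtain ⟨L, hL0, hL⟩ := hH.locallyBounded_F.exists_bound hH.isClosed_C R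
    have hap : ∀ s ∈ Set.Ioo (t - η) (t + η), ApproxTime U φ R (fun _ => (s, j)) (s, j) :=
      fun s hs => ⟨hev.mono fun k h => (h s hs).1, hev.mono fun k h => (h s hs).2,
        tendsto_const_nhds⟩
    have htm : t ∈ Set.Ioo (t - η) (t + η) := ⟨by linarith, by linarith⟩
    -- Over such a step `φ k` moves by less than `ρ / 2`, and its value at `t` is eventually within
    -- `ρ / 2` of the limit. The summand `1` avoids a zero denominator.
    have hη' : 0 < min η (ρ / (2 * (L + 1))) := lt_min hη (by positivity)
    refine Metric.isClosed_cthickening.mem_of_tendsto hder ?_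
    filter_upwards [Ioo_mem_nhdsGT hη'] with h hh
    have hh1 : h < η := hh.2.trans_le (min_le_left _ _)
    have hLh : L * h < ρ / 2 := by
      have h1 : h < ρ / (2 * (L + 1)) := hh.2.trans_le (min_le_right _ _)
      rw [lt_div_iff₀ (by positivity)] at h1
      nlinarith [hh.1]
    have hhm : t + h ∈ Set.Ioo (t - η) (t + η) := ⟨by linarith [hh.1], by linarith⟩
    refine Metric.isClosed_cthickening.mem_of_tendsto
      (((hft _ _ _ (hap _ hhm)).sub (hft _ _ _ (hap t htm))).const_smul h⁻¹) ?_
    filter_upwards [hev, Metric.tendsto_nhds.1 (hft _ _ _ (hap t htm)) (ρ / 2) (by linarith)]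
      with k hk hkρ
    have hlt : t < t + h := by linarith [hh.1]
    have hslope := ((φ k).locallyAbsolutelyContinuous j t (t + h) (hk t htm).1
      (hk _ hhm).1).slope_mem (S := Metric.cthickening ε (H.F (f (t, j)))) hlt
      ((hH.convex_F _ hx).cthickening ε) Metric.isClosed_cthickening (by
        filter_upwards [(hsol k).ae_flow (hk t htm).1 (hk _ hhm).1] with s hs hsm
        obtain ⟨hsC, w, hw, hwd⟩ := hs hsm
        refine ⟨w, Metric.thickening_subset_cthickening _ _ (hρF _ hsC ?_ hw), hwd⟩
        have hsm' : s ∈ Set.Ioo (t - η) (t + η) := ⟨by linarith [hsm.1], by linarith [hsm.2]⟩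
        have h1 := (hsol k).norm_sub_le hL hsm.1.le (hk t htm).1 (hk s hsm').1 (hk s hsm').2
        have h2 : L * (s - t) ≤ L * h :=
          mul_le_mul_of_nonneg_left (by linarith [hsm.2]) hL0
        have h3 := dist_triangle ((φ k).toFun (s, j)) ((φ k).toFun (t, j)) (f (t, j))
        rw [dist_eq_norm ((φ k).toFun (s, j)) ((φ k).toFun (t, j))] at h3
        linarith)
    simpa using hslope
  · obtain ⟨-, qa, Ra, ha, -⟩ := h
    obtain ⟨-, qb, R, hb, -⟩ := h'
    have hex : ∀ k, ∃ s, qa k ∈ (φ k).dom → qb k ∈ (φ k).dom → (qa k).2 = j →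
        (qb k).2 = j + 1 → (qa k).1 ≤ s ∧ s ≤ (qb k).1 ∧ (s, j) ∈ (φ k).dom ∧
          (s, j + 1) ∈ (φ k).dom := by
      intro k
      by_cases hk : qa k ∈ (φ k).dom ∧ qb k ∈ (φ k).dom ∧ (qa k).2 = j ∧ (qb k).2 = j + 1
      · obtain ⟨h1, h2, h3, h4⟩ := hk
        obtain ⟨P, hP, hPtop⟩ := htop k
        have hlt : (qa k).2 < (qb k).2 := by omega
        obtain ⟨s, hs⟩ := (φ k).isHybridTimeDomain.exists_jump h2 h1
          ⟨(φ k).isHybridTimeDomain.fst_le_of_snd_lt hP h1 h2 (hPtop h1) (hPtop h2) hlt,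
            hlt.le⟩ hlt
        rw [h3] at hs
        exact ⟨s, fun _ _ _ _ => hs⟩
      · exact ⟨0, fun h1 h2 h3 h4 => absurd ⟨h1, h2, h3, h4⟩ hk⟩
    -- The jump times `s k` are squeezed between two families of times that both tend to `t`.
    choose s hs using hex
    have hs' : ∀ᶠ k in (U : Filter ι), (qa k).1 ≤ s k ∧ s k ≤ (qb k).1 ∧ (s k, j) ∈ (φ k).dom ∧
        (s k, j + 1) ∈ (φ k).dom := by
      filter_upwards [ha.mem_dom, hb.mem_dom, ha.snd_eq, hb.snd_eq] with k h1 h2 h3 h4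
        using hs k h1 h2 h3 h4
    have hst : Tendsto s U (𝓝 t) := tendsto_of_tendsto_of_tendsto_of_le_of_le'
      ha.fst_tendsto hb.fst_tendsto (hs'.mono fun k h => h.1) (hs'.mono fun k h => h.2.1)
    have h1 : ApproxTime U φ R (fun k => (s k, j)) (t, j) := by
      refine hb.mono ?_ (hs'.mono fun k h => h.2.2.1) (tendsto_level hst j)
      filter_upwards [hs', hb.snd_eq] with k h h'
      exact ⟨h.2.1, by simp [h']⟩
    have h2 : ApproxTime U φ R (fun k => (s k, j + 1)) (t, j + 1) := by
      refine hb.mono ?_ (hs'.mono fun k h => h.2.2.2) (tendsto_level hst _)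
      filter_upwards [hs', hb.snd_eq] with k h h'
      exact ⟨h.2.1, by simp [h']⟩
    have hj : ∀ᶠ k in (U : Filter ι), (φ k).toFun (s k, j) ∈ H.D ∧
        (φ k).toFun (s k, j + 1) ∈ H.G ((φ k).toFun (s k, j)) :=
      hs'.mono fun k h => (hsol k).jump _ _ h.2.2.1 h.2.2.2
    have hD : f (t, j) ∈ H.D :=
      hH.isClosed_D.mem_of_tendsto (hft _ _ _ h1) (hj.mono fun k h => h.1)
    exact ⟨hD, hH.osc_G.mem_of_tendsto hD (hj.mono fun k h => h.1) (hj.mono fun k h => h.2)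
      (hft _ _ _ h1) (hft _ _ _ h2)⟩

end HybridSystem

/-! ### Convergence, limits of long segments, and finite horizons. -/

namespace HybridArc

variable {n : ℕ}

theorem convergesTo_iff {φ : HybridArc n} {X : Set (EuclideanSpace ℝ (Fin n))} :
    φ.ConvergesTo X ↔ ∀ ε > 0, ∃ T : ℝ, ∀ p ∈ φ.dom, T ≤ p.1 + (p.2 : ℝ) →
      Metric.infDist (φ.toFun p) X < ε := by
  unfold ConvergesTo
  have hb := ((atTop_basis (α := ℝ)).comap (fun p : ℝ × ℕ => p.1 + (p.2 : ℝ))).inf_principal φ.dom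
  rw [hb.tendsto_iff Metric.nhds_basis_ball]
  refine forall₂_congr fun ε _ => ?_
  simp only [true_and, Metric.mem_ball, Real.dist_eq, sub_zero,
    abs_of_nonneg Metric.infDist_nonneg]
  exact exists_congr fun T => ⟨fun h p hp hT => h p ⟨hT, hp⟩, fun h p hp => h p hp.2 hp.1⟩

end HybridArc

namespace HybridSystem

open HybridArc

variable {n : ℕ} {H : HybridSystem n}

/-- The portion of a solution between two times is a solution. -/
theorem IsSolution.exists_segment {φ : HybridArc n} (hφ : H.IsSolution φ) {s p : ℝ × ℕ}
    (hs : s ∈ φ.dom) (hp : p ∈ φ.dom) (hsp : s ≤ p) (hne : s ≠ p) :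
    ∃ (χ : HybridArc n) (q : ℝ × ℕ), H.IsSolution χ ∧ q ∈ χ.dom ∧ χ.dom ⊆ Set.Iic q ∧
      s + q = p ∧ χ.init = φ.toFun s ∧
      ∀ r ∈ χ.dom, s + r ∈ φ.dom ∧ s + r ≤ p ∧ χ.toFun r = φ.toFun (s + r) := by
  have hs' : s ∈ (φ.truncate p hp).dom := ⟨hs, hsp⟩
  have hp' : p ∈ (φ.truncate p hp).dom := ⟨hp, Set.mem_Iic.2 le_rfl⟩
  have hadd : s + (p.1 - s.1, p.2 - s.2) = p :=
    Prod.ext (by simp) (by simpa using Nat.add_sub_cancel' hsp.2)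
  refine ⟨(φ.truncate p hp).tail s hs', (p.1 - s.1, p.2 - s.2),
    (hφ.truncate hp).tail hs' hp' hsp hne, ⟨sub_nonneg.2 hsp.1, ?_⟩, ?_, hadd, ?_, ?_⟩
  · rw [hadd]; exact hp'
  · rintro r ⟨-, -, hr⟩
    have h1 : s.1 + r.1 ≤ p.1 := hr.1
    have h2 : s.2 + r.2 ≤ p.2 := hr.2
    exact ⟨by simp only; linarith, by simp only; omega⟩
  · change φ.toFun (s + 0) = _
    rw [add_zero]
  · rintro r ⟨-, hr, hr'⟩
    exact ⟨hr, hr', rfl⟩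

section Limits

variable {ι : Type*} {U : Ultrafilter ι} {φ : ι → HybridArc n}

theorem approxTime_zero {R : ℝ} (hinit : ∀ᶠ k in (U : Filter ι), ‖(φ k).init‖ ≤ R) :
    ApproxTime U φ R (fun _ => (0, 0)) (0, 0) := by
  refine ⟨Eventually.of_forall fun k => (φ k).zero_mem_dom, ?_, tendsto_const_nhds⟩
  filter_upwards [hinit] with k hk r hr hle
  rwa [le_antisymm hle ((φ k).isHybridTimeDomain.zero_le hr)]

theorem length_tendsto {q : ι → ℝ × ℕ} {p : ℝ × ℕ} (h : Tendsto q U (𝓝 p)) :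
    Tendsto (fun k => (q k).1 + ((q k).2 : ℝ)) U (𝓝 (p.1 + p.2)) :=
  ((continuous_fst.add (continuous_of_discreteTopology.comp continuous_snd) :
    Continuous fun q : ℝ × ℕ => q.1 + (q.2 : ℝ)).tendsto p).comp h

theorem length_le_of_le {r q : ℝ × ℕ} (h : r ≤ q) : r.1 + (r.2 : ℝ) ≤ q.1 + q.2 :=
  add_le_add h.1 (Nat.cast_le.2 h.2)

/-- Longer and longer solutions that stay away from `X` produce in the limit a solution that does
not converge to `X`. -/
theorem exists_not_convergesTo (hH : H.BasicConditions) (hsol : ∀ k, H.IsSolution (φ k))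
    {p : ι → ℝ × ℕ} (hp : ∀ k, p k ∈ (φ k).dom) (htop : ∀ k, (φ k).dom ⊆ Set.Iic (p k))
    (hlen : ∀ T : ℝ, ∀ᶠ k in (U : Filter ι), T ≤ (p k).1 + ((p k).2 : ℝ))
    (hbd : ∀ T : ℝ, ∃ R, ∀ᶠ k in (U : Filter ι), ∀ q ∈ (φ k).dom, q.1 + (q.2 : ℝ) ≤ T →
      ‖(φ k).toFun q‖ ≤ R)
    {X : Set (EuclideanSpace ℝ (Fin n))} {δ : ℝ} (hδ : 0 < δ)
    (hX : ∀ᶠ k in (U : Filter ι), ∀ q ∈ (φ k).dom, 1 ≤ q.1 + (q.2 : ℝ) →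
      δ ≤ Metric.infDist ((φ k).toFun q) X) :
    ∃ ψ, H.IsSolution ψ ∧ Tendsto (fun k => (φ k).init) U (𝓝 ψ.init) ∧ ¬ ψ.ConvergesTo X := by
  obtain ⟨R₀, hR₀⟩ := hbd 0
  have hinit : ∀ᶠ k in (U : Filter ι), ‖(φ k).init‖ ≤ R₀ := by
    filter_upwards [hR₀] with k hk using hk _ (φ k).zero_mem_dom (by simp)
  obtain ⟨ψ, hψ, -, hlim⟩ :=
    exists_graphical_limit hH hsol (fun k => ⟨p k, hp k, htop k⟩) hinit
  refine ⟨ψ, hψ, (hlim _ _ _ (approxTime_zero hinit)).2, fun hconv => ?_⟩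
  obtain ⟨T, hT⟩ := convergesTo_iff.1 hconv δ hδ
  have hT1 : (0 : ℝ) ≤ max T 1 := zero_le_one.trans (le_max_right _ _)
  have hex : ∀ k, ∃ q, max T 1 ≤ (p k).1 + ((p k).2 : ℝ) → q ∈ (φ k).dom ∧
      max T 1 ≤ q.1 + (q.2 : ℝ) ∧ q.1 + (q.2 : ℝ) ≤ max T 1 + 1 := by
    intro k
    by_cases hk : max T 1 ≤ (p k).1 + ((p k).2 : ℝ)
    · obtain ⟨q, h1, -, h3, h4⟩ :=
        (φ k).isHybridTimeDomain.exists_length_mem_Icc (hp k) hT1 hk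
      exact ⟨q, fun _ => ⟨h1, h3, h4⟩⟩
    · exact ⟨0, fun h => absurd h hk⟩
  -- Beyond any `T` there are times of length at most `max T 1 + 1`, hence with a limit `P` in the
  -- domain of `ψ`. The maximum with `1` makes `hX` applicable.
  choose q hq using hex
  have hq' := (hlen (max T 1)).mono hq
  obtain ⟨P, hP⟩ := exists_tendsto_of_length_le (hq'.mono fun k h => h.1)
    (hq'.mono fun k h => h.2.2)
  obtain ⟨R, hR⟩ := hbd (max T 1 + 1)
  have hap : ApproxTime U φ R q P := by
    refine ⟨hq'.mono fun k h => h.1, ?_, hP⟩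
    filter_upwards [hR, hq'] with k h1 h2 r hr hrq
    exact h1 r hr ((length_le_of_le hrq).trans h2.2.2)
  obtain ⟨hPd, hPt⟩ := hlim _ _ _ hap
  have h1 : max T 1 ≤ P.1 + (P.2 : ℝ) :=
    ge_of_tendsto (length_tendsto hP) (hq'.mono fun k h => h.2.1)
  have h2 : δ ≤ Metric.infDist (ψ.toFun P) X := by
    refine ge_of_tendsto (((Metric.continuous_infDist_pt X).tendsto _).comp hPt) ?_
    filter_upwards [hX, hq'] with k h3 h4
    exact h3 _ h4.1 ((le_max_right _ _).trans h4.2.1)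
  exact (hT P hPd ((le_max_left _ _).trans h1)).not_ge h2

end Limits

theorem eventually_hyperfilter_of_atTop {P : ℕ → Prop} (h : ∀ᶠ k in atTop, P k) :
    ∀ᶠ k in (hyperfilter ℕ : Filter ℕ), P k :=
  h.filter_mono Nat.hyperfilter_le_atTop

theorem eventually_hyperfilter_le (T : ℝ) : ∀ᶠ k : ℕ in (hyperfilter ℕ : Filter ℕ), T ≤ k :=
  eventually_hyperfilter_of_atTop (tendsto_natCast_atTop_atTop.eventually_ge_atTop T)

/-- In the absence of finite escape, reachable sets over bounded horizons are bounded. -/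
theorem exists_bound_of_length_le (hH : H.BasicConditions)
    {K : Set (EuclideanSpace ℝ (Fin n))} (hK : IsCompact K)
    (hb : ∀ φ, H.IsSolution φ → φ.init ∈ K → ¬ φ.IsComplete → φ.IsBounded) (T : ℝ) :
    ∃ R, ∀ φ, H.IsSolution φ → φ.init ∈ K → ∀ p ∈ φ.dom, p.1 + (p.2 : ℝ) ≤ T →
      ‖φ.toFun p‖ ≤ R := by
  by_contra! hcon
  choose φ hsol hinit p hp hpT hpn using fun k : ℕ => hcon k
  obtain ⟨R₀, hR₀⟩ := hK.isBounded.exists_norm_le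
  let χ : ℕ → HybridArc n := fun k => (φ k).truncate (p k) (hp k)
  have hχsol : ∀ k, H.IsSolution (χ k) := fun k => (hsol k).truncate (hp k)
  have hχp : ∀ k, p k ∈ (χ k).dom := fun k => ⟨hp k, Set.mem_Iic.2 le_rfl⟩
  have hχtop : ∀ k, (χ k).dom ⊆ Set.Iic (p k) := fun k => Set.inter_subset_right
  have hχinit : ∀ k, ‖(χ k).init‖ ≤ R₀ := fun k => hR₀ _ (hinit k)
  obtain ⟨ψ, hψ, hψlim, hlim⟩ := exists_graphical_limit (U := hyperfilter ℕ) hH hχsol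
    (fun k => ⟨p k, hχp k, hχtop k⟩) (Eventually.of_forall hχinit)
  have hψinit : ψ.init ∈ K := hK.isClosed.mem_of_tendsto
    (hlim _ _ _ (approxTime_zero (Eventually.of_forall hχinit))).2
    (Eventually.of_forall hinit)
  have hψT : ∀ P ∈ ψ.dom, P.1 + (P.2 : ℝ) ≤ T := by
    intro P hP
    obtain ⟨q, R, hq, -⟩ := hψlim P hP
    refine le_of_tendsto (length_tendsto hq.tendsto) ?_
    filter_upwards [hq.mem_dom] with k hk
    exact (length_le_of_le (hχtop k hk)).trans (hpT k)
  -- The limit has length at most `T`, so it is not complete and the hypothesis bounds it.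
  have hψb : ψ.IsBounded := by
    refine hb ψ hψ hψinit fun hc => ?_
    obtain ⟨P, hP, hPT⟩ := hc (T + 1)
    linarith [hψT P hP]
  obtain ⟨B, hB⟩ := hψb.exists_norm_le
  -- A level above any value of `ψ`. Until its first crossing an arc is bounded by `R`, and at the
  -- crossing by `max R L`; hence the crossings have a limit in the domain of `ψ`, where its norm is
  -- at least `R`.
  set R := max B R₀ + 1 with hRdef
  obtain ⟨L, -, hL⟩ := hH.locallyBounded_G.exists_bound hH.isClosed_D R
  have hex : ∀ k : ℕ, ∃ q, R ≤ k → q ∈ (χ k).dom ∧ R ≤ ‖(χ k).toFun q‖ ∧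
      ∀ r ∈ (χ k).dom, r ≤ q → r ≠ q → ‖(χ k).toFun r‖ ≤ R := by
    intro k
    by_cases hk : R ≤ k
    · obtain ⟨q, hq, -, hqA, hqb⟩ := (χ k).exists_first_mem (hχp k)
        (isClosed_le continuous_const continuous_norm : IsClosed {x | R ≤ ‖x‖})
        (hk.trans (hpn k).le)
      exact ⟨q, fun _ => ⟨hq, hqA, fun r hr hle hne => (not_le.1 (hqb r hr hle hne)).le⟩⟩
    · exact ⟨0, fun h => absurd h hk⟩
  choose q hq using hex
  have hq' := (eventually_hyperfilter_le R).mono hq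
  obtain ⟨P, hP⟩ := exists_tendsto_of_length_le (hq'.mono fun k h => h.1)
    (hq'.mono fun k h => (length_le_of_le (hχtop k h.1)).trans (hpT k))
  have hap : ApproxTime (hyperfilter ℕ) χ (max R L) q P := by
    refine ⟨hq'.mono fun k h => h.1, hq'.mono fun k h r hr hrq => ?_, hP⟩
    by_cases hne : r = q k
    · rw [hne]
      exact (hχsol k).norm_le_of_before hL h.1
        ((hχinit k).trans (by rw [hRdef]; linarith [le_max_right B R₀])) h.2.2
    · exact (h.2.2 r hr hrq hne).trans (le_max_left _ _)
  obtain ⟨hPd, hPt⟩ := hlim _ _ _ hap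
  have h1 : R ≤ ‖ψ.toFun P‖ := ge_of_tendsto hPt.norm (hq'.mono fun k h => h.2.1)
  have h2 := hB _ (Set.mem_image_of_mem _ hPd)
  linarith [le_max_left B R₀]

/-! ### Distance to a compact set and exit segments. -/

section Distance

variable {X Y : Set (EuclideanSpace ℝ (Fin n))}

theorem exists_norm_le_add_infDist (hX : IsCompact X) (hne : X.Nonempty) :
    ∃ B, 0 < B ∧ ∀ x, ‖x‖ ≤ B + Metric.infDist x X := by
  obtain ⟨B, hB⟩ := hX.isBounded.exists_norm_le
  refine ⟨max B 1, by positivity, fun x => ?_⟩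
  obtain ⟨y, hy, hd⟩ := hX.exists_infDist_eq_dist hne x
  have h1 := norm_le_norm_add_norm_sub' x y
  rw [hd, dist_eq_norm]
  linarith [hB y hy, le_max_left B 1]

/-- Stability of a compact set, without the auxiliary bound on initial conditions. -/
theorem StableRel.exists_infDist_lt (h : H.StableRel X Y) (hX : IsCompact X) (hne : X.Nonempty)
    {ε : ℝ} (hε : 0 < ε) : ∃ δ > 0, δ ≤ ε ∧ ∀ φ, H.IsSolution φ → φ.init ∈ Y →
      Metric.infDist φ.init X < δ → ∀ p ∈ φ.dom, Metric.infDist (φ.toFun p) X < ε := by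
  obtain ⟨B, hB0, hB⟩ := exists_norm_le_add_infDist hX hne
  -- Points at distance less than `1` from `X` have norm less than `B + 1`.
  obtain ⟨δ, hδ, h⟩ := h ε hε (B + 1) (by positivity)
  refine ⟨min δ (min ε 1), by positivity, (min_le_right _ _).trans (min_le_left _ _),
    fun φ hφ hi hd p hp => ?_⟩
  rw [← Metric.mem_thickening_iff_infDist_lt hne]
  refine h φ hφ hi ⟨?_, ?_⟩ p hp
  · rw [Metric.mem_thickening_iff_infDist_lt hne]
    exact hd.trans_le (min_le_left _ _)
  · rw [mem_ball_zero_iff]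
    have := hd.trans_le ((min_le_right _ _).trans (min_le_right _ _))
    linarith [hB φ.init]

/-- A solution that is at distance `ε` from a stable set has not come closer than `δ` before. -/
theorem IsSolution.le_infDist_of_le {φ : HybridArc n} (hφ : H.IsSolution φ)
    (hY : ∀ p ∈ φ.dom, φ.toFun p ∈ Y) {δ ε : ℝ} (hδε : δ ≤ ε)
    (hst : ∀ φ, H.IsSolution φ → φ.init ∈ Y → Metric.infDist φ.init X < δ →
      ∀ p ∈ φ.dom, Metric.infDist (φ.toFun p) X < ε) {p r : ℝ × ℕ} (hp : p ∈ φ.dom)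
    (hpε : ε ≤ Metric.infDist (φ.toFun p) X) (hr : r ∈ φ.dom) (hrp : r ≤ p) :
    δ ≤ Metric.infDist (φ.toFun r) X := by
  by_cases hne : r = p
  · rw [hne]; exact hδε.trans hpε
  · by_contra! hlt
    obtain ⟨χ, q, hχ, hq, -, hadd, hχi, hχr⟩ := hφ.exists_segment hr hp hrp hne
    have := hst χ hχ (hχi ▸ hY r hr) (hχi ▸ hlt) q hq
    rw [(hχr q hq).2.2, hadd] at this
    exact this.not_ge hpε

/-- The portion of a solution from its last visit near `X` to its first exit. -/
theorem IsSolution.exists_exit_segment {φ : HybridArc n} (hφ : H.IsSolution φ) {δ ε : ℝ}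
    (hδε : δ < ε) (hi : Metric.infDist φ.init X ≤ δ) {p : ℝ × ℕ} (hp : p ∈ φ.dom)
    (hpε : ε ≤ Metric.infDist (φ.toFun p) X) :
    ∃ (χ : HybridArc n) (q : ℝ × ℕ), H.IsSolution χ ∧ q ∈ χ.dom ∧ χ.dom ⊆ Set.Iic q ∧
      Metric.infDist χ.init X ≤ δ ∧ ε ≤ Metric.infDist (χ.toFun q) X ∧
      (∀ r ∈ χ.dom, r ≠ q → Metric.infDist (χ.toFun r) X < ε) ∧
      (∀ r ∈ χ.dom, r ≠ 0 → δ < Metric.infDist (χ.toFun r) X) ∧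
      ∀ r ∈ χ.dom, ∃ r' ∈ φ.dom, χ.toFun r = φ.toFun r' := by
  have hc := Metric.continuous_infDist_pt X
  obtain ⟨p', hp', -, hp'ε, hbefore⟩ := φ.exists_first_mem hp
    (isClosed_le continuous_const hc : IsClosed {x | ε ≤ Metric.infDist x X}) hpε
  obtain ⟨s, hs, hsp, hsδ, hafter⟩ := φ.exists_last_mem hp'
    (isClosed_le hc continuous_const : IsClosed {x | Metric.infDist x X ≤ δ})
    φ.zero_mem_dom (φ.isHybridTimeDomain.zero_le hp') hi
  have hne : s ≠ p' := by
    rintro rfl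
    exact hδε.not_ge (le_trans hp'ε hsδ)
  obtain ⟨χ, q, hχ, hq, htop, hadd, hχi, hχr⟩ := hφ.exists_segment hs hp' hsp hne
  refine ⟨χ, q, hχ, hq, htop, hχi ▸ hsδ, ?_, fun r hr hrq => ?_, fun r hr hr0 => ?_,
    fun r hr => ⟨_, (hχr r hr).1, (hχr r hr).2.2⟩⟩
  · rw [(hχr q hq).2.2, hadd]; exact hp'ε
  · obtain ⟨h1, h2, h3⟩ := hχr r hr
    rw [h3]
    refine not_le.1 (hbefore _ h1 h2 fun h => hrq ?_)
    rw [← hadd] at h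
    exact add_left_cancel h
  · obtain ⟨h1, h2, h3⟩ := hχr r hr
    rw [h3]
    refine not_le.1 (hafter _ h1 h2 ?_ fun h => hr0 ?_)
    · have := χ.isHybridTimeDomain.zero_le hr
      exact ⟨by simpa using this.1, by simp⟩
    · exact add_left_cancel (h.trans (add_zero s).symm)

end Distance

/-! ### The nested sets. -/

section Cascade

variable {Me Mi Mo : Set (EuclideanSpace ℝ (Fin n))}

/-- Stability is inherited through the nested set `Mi`. -/
theorem stableRel_of_nested (hH : H.BasicConditions) (hMi : IsClosed Mi)
    (hMi_stable : H.StableRel Mi Me) (hMo : IsCompact Mo) (hMo_ne : Mo.Nonempty)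
    (hMo_sub : Mo ⊆ Mi) (hMo_stable : H.StableRel Mo Mi) (hMo_attr : H.AttractiveRel Mo Mi) :
    H.StableRel Mo Me := by
  intro ε hε Δ _
  obtain ⟨δ₀, hδ₀, hattr⟩ := hMo_attr
  obtain ⟨δ₁, hδ₁, hδ₁ε, hst⟩ := hMo_stable.exists_infDist_lt hMo hMo_ne hε
  obtain ⟨B, hB0, hB⟩ := exists_norm_le_add_infDist hMo hMo_ne
  have hMi_ne : Mi.Nonempty := hMo_ne.mono hMo_sub
  -- Halving leaves room for the strict inequalities: the limit satisfies only `infDist ≤ δ`, yet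
  -- must start within `δ₀` and `δ₁`.
  set δ := min δ₀ δ₁ / 2 with hδdef
  have hδ : 0 < δ := by positivity
  have hδ0 : δ < δ₀ := by
    have := min_le_left δ₀ δ₁
    linarith
  have hδ1 : δ < δ₁ := by
    have := min_le_right δ₀ δ₁
    linarith
  by_contra! hcon
  choose φ hφ hφi hφb p hp hpε using fun k : ℕ =>
    hcon (min δ (1 / ((k : ℝ) + 1))) (lt_min hδ Nat.one_div_pos_of_nat)
  have hφd : ∀ k, Metric.infDist (φ k).init Mo < min δ (1 / ((k : ℝ) + 1)) := fun k =>
    (Metric.mem_thickening_iff_infDist_lt hMo_ne).1 (hφb k).1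
  choose χ q hχ hq htop hχi hχq hχlt hχgt hχφ using fun k =>
    (hφ k).exists_exit_segment (hδ1.trans_le hδ₁ε) ((hφd k).le.trans (min_le_left _ _)) (hp k)
      (by simpa [Metric.mem_thickening_iff_infDist_lt hMo_ne] using hpε k)
  -- The arcs start ever closer to `Mo ⊆ Mi`, so stability of `Mi` keeps them ever closer to `Mi`;
  -- this puts the initial value of the limit in `Mi`.
  have hnear : ∀ ρ > 0, ∀ᶠ k in (hyperfilter ℕ : Filter ℕ), ∀ r ∈ (χ k).dom,
      Metric.infDist ((χ k).toFun r) Mi < ρ := by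
    intro ρ hρ
    obtain ⟨δρ, hδρ, h⟩ := hMi_stable ρ hρ (B + 1) (by positivity)
    refine eventually_hyperfilter_of_atTop ?_
    filter_upwards [(tendsto_order.1 (tendsto_one_div_add_atTop_nhds_zero_nat (𝕜 := ℝ))).2 δρ hδρ]
      with k hk r hr
    obtain ⟨r', hr', he⟩ := hχφ k r hr
    rw [he, ← Metric.mem_thickening_iff_infDist_lt hMi_ne]
    have hlt := (hφd k).trans_le (min_le_right _ _)
    refine h _ (hφ k) (hφi k) ⟨?_, ?_⟩ r' hr'
    · rw [Metric.mem_thickening_iff_infDist_lt hMi_ne]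
      exact (Metric.infDist_le_infDist_of_subset hMo_sub hMo_ne).trans_lt (hlt.trans hk)
    · rw [mem_ball_zero_iff]
      have h1 : 1 / ((k : ℝ) + 1) ≤ 1 := by
        rw [div_le_one (by positivity)]
        linarith [(Nat.cast_nonneg k : (0 : ℝ) ≤ k)]
      linarith [hB (φ k).init]
  obtain ⟨L, -, hL⟩ := hH.locallyBounded_G.exists_bound hH.isClosed_D (B + ε)
  have hlt : ∀ k, ∀ r ∈ (χ k).dom, r ≠ q k → ‖(χ k).toFun r‖ ≤ B + ε := fun k r hr hne =>
    (hB _).trans (by linarith [hχlt k r hr hne])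
  have hχ0 : ∀ k, ‖(χ k).init‖ ≤ B + ε := fun k =>
    (hB _).trans (by linarith [hχi k])
  have hbd : ∀ k, ∀ r ∈ (χ k).dom, ‖(χ k).toFun r‖ ≤ max (B + ε) L := by
    intro k r hr
    by_cases hne : r = q k
    · rw [hne]
      exact (hχ k).norm_le_of_before hL (hq k) (hχ0 k) fun r hr _ hne => hlt k r hr hne
    · exact (hlt k r hr hne).trans (le_max_left _ _)
  have hlimit : ∀ ψ, H.IsSolution ψ →
      Tendsto (fun k => (χ k).init) (hyperfilter ℕ : Filter ℕ) (𝓝 ψ.init) →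
      ψ.init ∈ Mi ∧ Metric.infDist ψ.init Mo ≤ δ := by
    intro ψ _ ht
    refine ⟨?_, le_of_tendsto (((Metric.continuous_infDist_pt Mo).tendsto _).comp ht)
      (Eventually.of_forall hχi)⟩
    rw [hMi.mem_iff_infDist_zero hMi_ne]
    refine le_antisymm (le_of_forall_pos_le_add fun ρ hρ => ?_) Metric.infDist_nonneg
    refine le_of_tendsto (((Metric.continuous_infDist_pt Mi).tendsto _).comp ht) ?_
    filter_upwards [hnear ρ hρ] with k hk
    rw [zero_add]
    exact (hk _ (χ k).zero_mem_dom).le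
  -- Bounded lengths: the exit times have a limit, where `ψ` is at distance at least `ε`. Otherwise
  -- the lengths tend to infinity along the ultrafilter and the limit cannot converge to `Mo`.
  by_cases hT : ∃ T : ℝ, ∀ᶠ k in (hyperfilter ℕ : Filter ℕ), (q k).1 + ((q k).2 : ℝ) ≤ T
  · obtain ⟨T, hT⟩ := hT
    obtain ⟨ψ, hψ, -, hlim⟩ := exists_graphical_limit (U := hyperfilter ℕ) hH hχ
      (fun k => ⟨q k, hq k, htop k⟩) (Eventually.of_forall hχ0)
    obtain ⟨P, hP⟩ := exists_tendsto_of_length_le (Eventually.of_forall hq) hT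
    obtain ⟨hPd, hPt⟩ := hlim _ _ _ (⟨Eventually.of_forall hq,
      Eventually.of_forall fun k r hr _ => hbd k r hr, hP⟩ :
        ApproxTime (hyperfilter ℕ) χ (max (B + ε) L) q P)
    obtain ⟨h1, h2⟩ := hlimit ψ hψ (hlim _ _ _ (approxTime_zero (Eventually.of_forall hχ0))).2
    have h3 : ε ≤ Metric.infDist (ψ.toFun P) Mo :=
      ge_of_tendsto (((Metric.continuous_infDist_pt Mo).tendsto _).comp hPt)
        (Eventually.of_forall hχq)
    exact (hst ψ hψ h1 (h2.trans_lt hδ1) P hPd).not_ge h3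
  · have hlen : ∀ T : ℝ, ∀ᶠ k in (hyperfilter ℕ : Filter ℕ), T ≤ (q k).1 + ((q k).2 : ℝ) := by
      intro T
      rcases (hyperfilter ℕ).em fun k => (q k).1 + ((q k).2 : ℝ) ≤ T with h | h
      · exact absurd ⟨T, h⟩ hT
      · exact h.mono fun k hk => (not_le.1 hk).le
    obtain ⟨ψ, hψ, ht, hnc⟩ := exists_not_convergesTo (U := hyperfilter ℕ) (X := Mo) hH hχ hq htop
      hlen (fun T => ⟨_, Eventually.of_forall fun k r hr _ => hbd k r hr⟩) hδ
      (Eventually.of_forall fun k r hr h1 => (hχgt k r hr fun h0 => by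
        rw [h0] at h1
        norm_num at h1).le)
    obtain ⟨h1, h2⟩ := hlimit ψ hψ ht
    exact hnc (hattr ψ hψ h1
      ((Metric.mem_thickening_iff_infDist_lt hMo_ne).2 (h2.trans_lt hδ0)))

/-- A solution in a bounded closed set `Q` that converges to `Mi` converges to `Mo`, provided that
all solutions from `Q ∩ Mi` do. -/
theorem convergesTo_of_nested (hH : H.BasicConditions)
    (hMe_inv : H.StronglyForwardInvariant Me) (hMi : IsClosed Mi) (hMo : IsCompact Mo)
    (hMo_ne : Mo.Nonempty) (hMo_sub : Mo ⊆ Mi) (hst : H.StableRel Mo Me)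
    {Q : Set (EuclideanSpace ℝ (Fin n))} (hQ : IsClosed Q) (hQb : Bornology.IsBounded Q)
    (hattr : ∀ ψ, H.IsSolution ψ → ψ.init ∈ Q → ψ.init ∈ Mi → ψ.ConvergesTo Mo)
    {φ : HybridArc n} (hφ : H.IsSolution φ) (hφi : φ.init ∈ Me)
    (hφQ : ∀ p ∈ φ.dom, φ.toFun p ∈ Q) (hφMi : φ.ConvergesTo Mi) : φ.ConvergesTo Mo := by
  by_contra hcon
  rw [convergesTo_iff] at hcon
  push Not at hcon
  obtain ⟨ε, hε, hcon⟩ := hcon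
  have hMi_ne : Mi.Nonempty := hMo_ne.mono hMo_sub
  obtain ⟨δ, hδ, hδε, hst⟩ := hst.exists_infDist_lt hMo hMo_ne hε
  obtain ⟨R, hR⟩ := hQb.exists_norm_le
  -- With `s k` of length in `[k, k + 1]` and `p k` of length at least `2k + 2`, the segments both
  -- start arbitrarily late and become arbitrarily long.
  choose p hp hplen hpε using fun k : ℕ => hcon (2 * k + 2)
  have hk0 : ∀ k : ℕ, (0 : ℝ) ≤ k := fun k => Nat.cast_nonneg k
  choose s hs hsp hslen hslen' using fun k : ℕ =>
    φ.isHybridTimeDomain.exists_length_mem_Icc (hp k) (hk0 k)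
      (by linarith [hplen k, hk0 k])
  have hne : ∀ k, s k ≠ p k := fun k h => by
    have := hslen' k
    rw [h] at this
    linarith [hplen k, hk0 k]
  choose χ q hχ hq htop hadd hχi hχr using fun k =>
    hφ.exists_segment (hs k) (hp k) (hsp k) (hne k)
  have hlen : ∀ T : ℝ, ∀ᶠ k in (hyperfilter ℕ : Filter ℕ), T ≤ (q k).1 + ((q k).2 : ℝ) := by
    intro T
    filter_upwards [eventually_hyperfilter_le T] with k hk
    have h1 := hplen k
    rw [← hadd k] at h1
    simp only [Prod.fst_add, Prod.snd_add, Nat.cast_add] at h1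
    linarith [hslen' k]
  obtain ⟨ψ, hψ, ht, hnc⟩ := exists_not_convergesTo (U := hyperfilter ℕ) (X := Mo) hH hχ hq htop
    hlen (fun T => ⟨R, Eventually.of_forall fun k r hr _ => by
      rw [(hχr k r hr).2.2]
      exact hR _ (hφQ _ (hχr k r hr).1)⟩) hδ
    (Eventually.of_forall fun k r hr _ => by
      rw [(hχr k r hr).2.2]
      exact hφ.le_infDist_of_le (hMe_inv φ hφ hφi) hδε hst (hp k) (hpε k) (hχr k r hr).1
        (hχr k r hr).2.1)
  refine hnc (hattr ψ hψ ?_ ?_)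
  · exact hQ.mem_of_tendsto ht (Eventually.of_forall fun k => hχi k ▸ hφQ _ (hs k))
  · rw [hMi.mem_iff_infDist_zero hMi_ne]
    refine le_antisymm (le_of_forall_pos_le_add fun ρ hρ => ?_) Metric.infDist_nonneg
    obtain ⟨T, hT⟩ := convergesTo_iff.1 hφMi ρ hρ
    refine le_of_tendsto (((Metric.continuous_infDist_pt Mi).tendsto _).comp ht) ?_
    filter_upwards [eventually_hyperfilter_le T] with k hk
    rw [zero_add, Function.comp_apply, hχi k]
    exact (hT _ (hs k) (hk.trans (hslen k))).le

/-- A stable compact set attracts uniformly from compact subsets of its basin. -/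
theorem uniformlyAttractiveFrom_of_subset_basin (hH : H.BasicConditions)
    (hMe_inv : H.StronglyForwardInvariant Me) (hMo : IsCompact Mo) (hMo_ne : Mo.Nonempty)
    (hst : H.StableRel Mo Me) {K : Set (EuclideanSpace ℝ (Fin n))} (hK : IsCompact K)
    (hKb : K ⊆ H.basin Mo ∩ Me) : H.UniformlyAttractiveFrom Mo K := by
  intro ε hε
  by_contra! hcon
  obtain ⟨δ, hδ, hδε, hst⟩ := hst.exists_infDist_lt hMo hMo_ne hε
  choose φ hφ hφi p hp hplen hpε using fun k : ℕ => hcon k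
  -- The basin admits incomplete solutions only if bounded; this rules out finite escape and
  -- provides the local bounds needed for the limit.
  have hreach := exists_bound_of_length_le hH hK
    fun φ hφ hi => ((hKb hi).1 φ hφ rfl).1
  obtain ⟨ψ, hψ, ht, hnc⟩ := exists_not_convergesTo (U := hyperfilter ℕ) (X := Mo) hH
    (φ := fun k => (φ k).truncate (p k) (hp k)) (fun k => (hφ k).truncate (hp k))
    (p := p) (fun k => ⟨hp k, Set.mem_Iic.2 le_rfl⟩) (fun k => Set.inter_subset_right)
    (fun T => (eventually_hyperfilter_le T).mono fun k hk => hk.trans (hplen k))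
    (fun T => (hreach T).imp fun R hR => Eventually.of_forall fun k r hr hrT =>
      hR (φ k) (hφ k) (hφi k) r hr.1 hrT) hδ
    (Eventually.of_forall fun k r hr _ =>
      (hφ k).le_infDist_of_le (hMe_inv _ (hφ k) (hKb (hφi k)).2) hδε hst (hp k) (hpε k).le
        hr.1 hr.2)
  have hψK : ψ.init ∈ K := hK.isClosed.mem_of_tendsto ht (Eventually.of_forall hφi)
  exact hnc ((hKb hψK).1 ψ hψ rfl).2

/-- Convergence to a compact set bounds the values at large lengths, and the absence of finite
escape bounds the earlier ones. -/
theorem isBounded_of_mem_basin (hH : H.BasicConditions) (hMo : IsCompact Mo)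
    (hMo_ne : Mo.Nonempty) {φ : HybridArc n} (hφ : H.IsSolution φ)
    (hi : φ.init ∈ H.basin Mo) : φ.IsBounded := by
  obtain ⟨B, -, hB⟩ := exists_norm_le_add_infDist hMo hMo_ne
  obtain ⟨T, hT⟩ := convergesTo_iff.1 (hi φ hφ rfl).2 1 one_pos
  obtain ⟨R, hR⟩ := exists_bound_of_length_le hH (isCompact_singleton (x := φ.init))
    (fun ψ hψ hψi => (hi ψ hψ hψi).1) T
  refine isBounded_iff_forall_norm_le.2 ⟨max R (B + 1), ?_⟩
  rintro _ ⟨p, hp, rfl⟩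
  rcases le_total (p.1 + (p.2 : ℝ)) T with h | h
  · exact (hR φ hφ rfl p hp h).trans (le_max_left _ _)
  · exact (hB _).trans ((by linarith [hT p hp h] : _ ≤ B + 1).trans (le_max_right _ _))

theorem uasRel_of_nested (hH : H.BasicConditions) (hMe_inv : H.StronglyForwardInvariant Me)
    (hMi : IsClosed Mi) (hMi_stable : H.StableRel Mi Me) (hMo : IsCompact Mo)
    (hMo_ne : Mo.Nonempty) (hMo_sub : Mo ⊆ Mi) (hMo_stable : H.StableRel Mo Mi)
    (hMi_attr : H.AttractiveRel Mi Me) (hMo_attr : H.AttractiveRel Mo Mi) : H.UASRel Mo Me := by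
  have hst := stableRel_of_nested hH hMi hMi_stable hMo hMo_ne hMo_sub hMo_stable hMo_attr
  refine ⟨hst, ?_, fun K hK hKb =>
    uniformlyAttractiveFrom_of_subset_basin hH hMe_inv hMo hMo_ne hst hK hKb⟩
  obtain ⟨δi, hδi, hMi_attr⟩ := hMi_attr
  obtain ⟨δo, hδo, hMo_attr⟩ := hMo_attr
  -- Solutions starting within `δ` stay in the closed `δo / 2`-neighbourhood `Q` of `Mo`, all of
  -- which lies in the region of attraction relative to `Mi`.
  obtain ⟨δ, hδ, -, hδst⟩ := hst.exists_infDist_lt hMo hMo_ne (half_pos hδo)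
  obtain ⟨B, -, hB⟩ := exists_norm_le_add_infDist hMo hMo_ne
  refine ⟨min δ δi, lt_min hδ hδi, fun φ hφ hi hd => ?_⟩
  have hd' := (Metric.mem_thickening_iff_infDist_lt hMo_ne).1 hd
  refine convergesTo_of_nested hH hMe_inv hMi hMo hMo_ne hMo_sub hst
    (Q := {x | Metric.infDist x Mo ≤ δo / 2})
    (isClosed_le (Metric.continuous_infDist_pt Mo) continuous_const)
    (isBounded_iff_forall_norm_le.2 ⟨B + δo / 2, fun x hx => (hB x).trans ?_⟩)
    (fun ψ hψ h1 h2 => hMo_attr ψ hψ h2 ?_) hφ hi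
    (fun p hp => (hδst φ hφ hi (hd'.trans_le (min_le_left _ _)) p hp).le)
    (hMi_attr φ hφ hi ?_)
  · have : Metric.infDist x Mo ≤ δo / 2 := hx
    linarith
  · rw [Metric.mem_thickening_iff_infDist_lt hMo_ne]
    exact lt_of_le_of_lt h1 (half_lt_self hδo)
  · exact Metric.thickening_subset_of_subset _ hMo_sub
      (Metric.thickening_mono (min_le_right _ _) _ hd)

/-- Under global attractivity, points of `Me` from which all solutions are bounded belong to the
basin of `Mo`. -/
theorem mem_basin_of_forall_isBounded (hH : H.BasicConditions)
    (hMe_inv : H.StronglyForwardInvariant Me) (hMi : IsClosed Mi) (hMo : IsCompact Mo)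
    (hMo_ne : Mo.Nonempty) (hMo_sub : Mo ⊆ Mi) (hst : H.StableRel Mo Me)
    (hMi_attr : H.GloballyAttractiveRel Mi Me) (hMo_attr : H.GloballyAttractiveRel Mo Mi)
    {x : EuclideanSpace ℝ (Fin n)} (hx : x ∈ Me)
    (hb : ∀ φ, H.IsSolution φ → φ.init = x → φ.IsBounded) : x ∈ H.basin Mo := by
  -- Global attractivity is used one initial point at a time, with a radius just large enough to
  -- contain that point.
  have hthick : ∀ {X : Set (EuclideanSpace ℝ (Fin n))}, X.Nonempty → ∀ y,
      y ∈ Metric.thickening (Metric.infDist y X + 1) X := fun hX y =>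
    (Metric.mem_thickening_iff_infDist_lt hX).2 (lt_add_one _)
  have hpos : ∀ (X : Set (EuclideanSpace ℝ (Fin n))) y, 0 < Metric.infDist y X + 1 :=
    fun X y => add_pos_of_nonneg_of_pos Metric.infDist_nonneg one_pos
  intro φ hφ hi
  refine ⟨fun _ => hb φ hφ hi, ?_⟩
  have hb' := hb φ hφ hi
  subst hi
  exact convergesTo_of_nested hH hMe_inv hMi hMo hMo_ne hMo_sub hst isClosed_closure
    (Q := closure (φ.toFun '' φ.dom)) hb'.closure
    (fun ψ hψ _ h2 => hMo_attr _ (hpos _ _) ψ hψ h2 (hthick hMo_ne _)) hφ hx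
    (fun p hp => subset_closure (Set.mem_image_of_mem _ hp))
    (hMi_attr _ (hpos _ _) φ hφ hx (hthick (hMo_ne.mono hMo_sub) _))

end Cascade

end HybridSystem

/-! ### The lemma. -/

theorem lemma1 {n : ℕ} (H : HybridSystem n) (hH : H.BasicConditions)
    (Me Mi Mo : Set (EuclideanSpace ℝ (Fin n)))
    (hMe : IsClosed Me) (hMe_inv : H.StronglyForwardInvariant Me)
    (hMi : IsClosed Mi) (hMi_sub : Mi ⊆ Me) (hMi_stable : H.StableRel Mi Me)
    (hMo : IsCompact Mo) (hMo_ne : Mo.Nonempty) (hMo_sub : Mo ⊆ Mi)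
    (hMo_stable : H.StableRel Mo Mi) :
    (H.GloballyAttractiveRel Mi Me → H.GloballyAttractiveRel Mo Mi →
      H.UASRel Mo Me ∧
      IsGreatest {S : Set (EuclideanSpace ℝ (Fin n)) |
        S ⊆ Me ∧ ∀ φ, H.IsSolution φ → φ.init ∈ S → φ.IsBounded} (H.basin Mo ∩ Me) ∧
      (H.UGBRel Me → H.UGASRel Mo Me)) ∧
    (H.AttractiveRel Mi Me → H.AttractiveRel Mo Mi → H.UASRel Mo Me) := by
  have huas := HybridSystem.uasRel_of_nested hH hMe_inv hMi hMi_stable hMo hMo_ne hMo_sub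
    hMo_stable
  refine ⟨fun hMi_attr hMo_attr => ?_, huas⟩
  have hU := huas ⟨1, one_pos, hMi_attr 1 one_pos⟩ ⟨1, one_pos, hMo_attr 1 one_pos⟩
  have hbasin : ∀ x ∈ Me, (∀ φ, H.IsSolution φ → φ.init = x → φ.IsBounded) → x ∈ H.basin Mo :=
    fun x => HybridSystem.mem_basin_of_forall_isBounded hH hMe_inv hMi hMo hMo_ne hMo_sub hU.1
      hMi_attr hMo_attr
  refine ⟨hU, ⟨⟨Set.inter_subset_right, fun φ hφ hi =>
    HybridSystem.isBounded_of_mem_basin hH hMo hMo_ne hφ hi.1⟩, fun S hS x hx =>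
    ⟨hbasin x (hS.1 hx) fun φ hφ hi => hS.2 φ hφ (hi ▸ hx), hS.1 hx⟩⟩, fun hUGB =>
    ⟨hU, Set.inter_eq_right.2 fun x hx => hbasin x hx fun φ hφ hi => ?_⟩⟩
  -- Uniform boundedness is needed only from single points.
  obtain ⟨Δ, -, hΔ⟩ := hUGB {x} isCompact_singleton (Set.singleton_subset_iff.2 hx)
  refine isBounded_iff_forall_norm_le.2 ⟨Δ, ?_⟩
  rintro _ ⟨p, hp, rfl⟩
  exact (hΔ φ hφ hi p hp).le
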